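/- Let $s[n],b[n],w[n]$, $n\in\mathbb Z$, be zero-mean circularly-symmetric complex Gaussian processes and let $k_b$ be uniformly distributed on $\{1,\dots,K_b\}$, with $s,b,w,k_b$ mutually independent. Assume that $s$ (the signal of interest) and $b$ (the interference) are cyclostationary with cyclic periods $K_s,K_b\ge 1$, that the variance of each of them averages to $1$ over a cyclic period, and that $w$ is white with unit variance. For fixed $\rho_{\rm SIR},\rho_{\rm SNR}>0$ and $N\ge1$ let $$\mathbf s=(s[1],\dots,s[N])^{\rm T},\quad \mathbf v=(v_1,\dots,v_N)^{\rm T},\quad v_n=\rho_{\rm SIR}^{-1/2}\,b[n-k_b]+\rho_{\rm SNR}^{-1/2}\,w[n],\quad \mathbf y=\mathbf s+\mathbf v$$ (the signal of interest is synchronized, $k_s=0$). Put $C_{ss}=\mathbb E[\mathbf s\mathbf s^{\rm H}]$, $C_{vv}(m)=\mathbb E[\mathbf v\mathbf v^{\rm H}\mid k_b=m]$, $C_{yy}(m)=C_{ss}+C_{vv}(m)$ (all depending on $N$). Assume that the largest eigenvalue of $C_{ss}$ is bounded uniformly in $N$ (for example, because the autocovariances of $s$ are absolutely summable), and assume the uniquely-detectable-shift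 condition: with $\psi_N(\mathbf y,k)=\frac1N\mathbf y^{\rm H}C_{yy}(k)^{-1}\mathbf y-1$, almost surely there is no $k\in\{1,\dots,K_b\}\setminus\{k_b\}$ such that $\lim_{N\to\infty}|\psi_N(\mathbf y,k)|=0$. Let $\widehat{\mathbf s}_{\rm MMSE}=\mathbb E[\mathbf s\mid\mathbf y]$, $\widehat{\mathbf s}_{\rm LMMSE}(m)=C_{ss}\,[C_{ss}+C_{vv}(m)]^{-1}\mathbf y$, let $\widehat k\in\arg\max_{m\in\{1,\dots,K_b\}}\mathbb P(k_b=m\mid\mathbf y)$ be the MAP estimator of $k_b$ (a measurable function of $\mathbf y$, ties being broken arbitrarily), and let $\widehat{\mathbf s}_{\text{MAP-QLMMSE}}=\widehat{\mathbf s}_{\rm LMMSE}(\widehat k)$. Then $$\lim_{N\to\infty}\frac{\mathbb E\big[\|\widehat{\mathbf s}_{\rm MMSE}-\mathbf s\|_2^2\big]}{\mathbb E\big[\|\widehat{\mathbf s}_{\text{MAP-QLMMSE}}-\mathbf s\|_2^2\big]}=1 .$$ -/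

import Mathlib

open MeasureTheory ProbabilityTheory Filter Topology
open scoped Matrix ENNReal

/-- `X` is a zero-mean, circularly-symmetric (proper) complex Gaussian process indexed by `ℤ`:
its finite-dimensional laws are Gaussian, its mean vanishes and its pseudo-covariance
`E[X n * X m]` vanishes. -/
structure IsCircularGaussianProcess {Ω : Type*} [MeasurableSpace Ω]
    (X : ℤ → Ω → ℂ) (μ : Measure Ω) : Prop where
  measurable : ∀ n, Measurable (X n)
  gaussian : IsGaussianProcess X μ
  mean_zero : ∀ n, ∫ ω, X n ω ∂μ = 0
  pseudoCov_zero : ∀ n m, ∫ ω, X n ω * X m ω ∂μ = 0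

/-- The autocovariance `E[X n * conj (X m)]` of a (zero-mean) process. -/
noncomputable def autocov {Ω : Type*} [MeasurableSpace Ω]
    (X : ℤ → Ω → ℂ) (μ : Measure Ω) (n m : ℤ) : ℂ :=
  ∫ ω, X n ω * star (X m ω) ∂μ

/-- (Zero-mean) cyclostationarity with cyclic period `K`. For circular Gaussian processes this
determines all finite-dimensional laws, so it is the same as strict-sense cyclostationarity. -/
def IsCyclostationary {Ω : Type*} [MeasurableSpace Ω]
    (X : ℤ → Ω → ℂ) (K : ℕ) (μ : Measure Ω) : Prop :=
  ∀ n m : ℤ, autocov X μ (n + K) (m + K) = autocov X μ n m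

/-- The (periodically time-varying) variance averages to one over a cyclic period. -/
def HasUnitAveragePower {Ω : Type*} [MeasurableSpace Ω]
    (X : ℤ → Ω → ℂ) (K : ℕ) (μ : Measure Ω) : Prop :=
  (1 / (K : ℝ)) * ∑ n ∈ Finset.range K, ∫ ω, ‖X n ω‖ ^ 2 ∂μ = 1

/-- The data of the noisy mixture: the signal of interest `s`, the interference `b`, the additive
noise `w`, the random time-shift `kb` of the interference, the two power ratios, and the cyclic
periods. -/
structure Mixture (Ω : Type*) where
  s : ℤ → Ω → ℂ
  b : ℤ → Ω → ℂ
  w : ℤ → Ω → ℂ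
  kb : Ω → ℕ
  ρSIR : ℝ
  ρSNR : ℝ
  Ks : ℕ
  Kb : ℕ

namespace Mixture

variable {Ω : Type*} [MeasurableSpace Ω]

/-- Standing assumptions on the model: Gaussian cyclostationary unit-average-power signals, unit
variance white Gaussian noise, a uniform time-shift on `{1, …, Kb}`, and mutual independence of
the signal of interest, the interference, the noise and the time-shift. -/
structure IsGaussianModel (M : Mixture Ω) (μ : Measure Ω) : Prop where
  ρSIR_pos : 0 < M.ρSIR
  ρSNR_pos : 0 < M.ρSNR
  Ks_pos : 0 < M.Ks
  Kb_pos : 0 < M.Kb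
  s_gaussian : IsCircularGaussianProcess M.s μ
  s_cyclo : IsCyclostationary M.s M.Ks μ
  s_power : HasUnitAveragePower M.s M.Ks μ
  b_gaussian : IsCircularGaussianProcess M.b μ
  b_cyclo : IsCyclostationary M.b M.Kb μ
  b_power : HasUnitAveragePower M.b M.Kb μ
  w_gaussian : IsCircularGaussianProcess M.w μ
  w_white : ∀ n m : ℤ, autocov M.w μ n m = if n = m then 1 else 0
  kb_measurable : Measurable M.kb
  kb_uniform : ∀ m ∈ Finset.Icc 1 M.Kb, μ (M.kb ⁻¹' {m}) = (M.Kb : ℝ≥0∞)⁻¹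
  indep : iIndep
    ![MeasurableSpace.comap (fun ω n => M.s n ω) (inferInstance : MeasurableSpace (ℤ → ℂ)),
      MeasurableSpace.comap (fun ω n => M.b n ω) (inferInstance : MeasurableSpace (ℤ → ℂ)),
      MeasurableSpace.comap (fun ω n => M.w n ω) (inferInstance : MeasurableSpace (ℤ → ℂ)),
      MeasurableSpace.comap M.kb (inferInstance : MeasurableSpace ℕ)] μ

/-- The equivalent noise `ρSIR^(-1/2) b[n - kb] + ρSNR^(-1/2) w[n]` at time `n`. -/
noncomputable def v (M : Mixture Ω) (n : ℤ) (ω : Ω) : ℂ :=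
  ((√M.ρSIR)⁻¹ : ℝ) * M.b (n - M.kb ω) ω + ((√M.ρSNR)⁻¹ : ℝ) * M.w n ω

/-- The signal of interest at times `1, …, N` (it is synchronized: its time-shift is `0`). -/
noncomputable def sVec (M : Mixture Ω) (N : ℕ) (ω : Ω) : EuclideanSpace ℂ (Fin N) :=
  WithLp.toLp 2 fun i => M.s (((i : ℕ) : ℤ) + 1) ω

/-- The equivalent noise at times `1, …, N`. -/
noncomputable def vVec (M : Mixture Ω) (N : ℕ) (ω : Ω) : EuclideanSpace ℂ (Fin N) :=
  WithLp.toLp 2 fun i => M.v (((i : ℕ) : ℤ) + 1) ω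

/-- The observed mixture at times `1, …, N`. -/
noncomputable def yVec (M : Mixture Ω) (N : ℕ) (ω : Ω) : EuclideanSpace ℂ (Fin N) :=
  M.sVec N ω + M.vVec N ω

/-- The σ-algebra generated by the observation of length `N`. -/
noncomputable abbrev obs (M : Mixture Ω) (N : ℕ) : MeasurableSpace Ω :=
  MeasurableSpace.comap (M.yVec N) inferInstance

/-- Covariance matrix `E[s sᴴ]` of the synchronized signal of interest. -/
noncomputable def Css (M : Mixture Ω) (μ : Measure Ω) (N : ℕ) : Matrix (Fin N) (Fin N) ℂ :=
  Matrix.of fun i l => ∫ ω, M.sVec N ω i * star (M.sVec N ω l) ∂μ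

/-- Conditional covariance matrix `E[v vᴴ | kb = m]` of the equivalent noise. -/
noncomputable def Cvv (M : Mixture Ω) (μ : Measure Ω) (N m : ℕ) : Matrix (Fin N) (Fin N) ℂ :=
  Matrix.of fun i l => ∫ ω, M.vVec N ω i * star (M.vVec N ω l) ∂(μ[|M.kb ⁻¹' {m}])

/-- Covariance matrix of the mixture given that `kb = m`. -/
noncomputable def Cyy (M : Mixture Ω) (μ : Measure Ω) (N m : ℕ) : Matrix (Fin N) (Fin N) ℂ :=
  M.Css μ N + M.Cvv μ N m

/-- `ψ_N(y, k) = (1/N) yᴴ C_yy(k)⁻¹ y - 1`. -/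
noncomputable def ψ (M : Mixture Ω) (μ : Measure Ω) (N k : ℕ) (ω : Ω) : ℂ :=
  (1 / (N : ℂ)) * (star (M.yVec N ω).ofLp ⬝ᵥ ((M.Cyy μ N k)⁻¹ *ᵥ (M.yVec N ω).ofLp)) - 1

/-- The uniquely-detectable-shift condition: almost surely, there is no shift `k` in
`{1, …, Kb}`, other than the true one, for which `|ψ_N(y, k)| → 0`. -/
def USC (M : Mixture Ω) (μ : Measure Ω) : Prop :=
  ∀ᵐ ω ∂μ, ¬ ∃ k ∈ Finset.Icc 1 M.Kb, k ≠ M.kb ω ∧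
    Tendsto (fun N : ℕ => ‖M.ψ μ N k ω‖) atTop (𝓝 0)

/-- The eigenvalues of the covariance matrices `E[s sᴴ]` of the signal of interest are bounded
uniformly in the observation length. -/
def HasBoundedSpectrum (M : Mixture Ω) (μ : Measure Ω) : Prop :=
  ∃ Λ : ℝ, ∀ (N : ℕ) (c : Fin N → ℂ),
    (star c ⬝ᵥ (M.Css μ N *ᵥ c)).re ≤ Λ * ∑ i, ‖c i‖ ^ 2

/-- The LMMSE estimator of the signal of interest for the interference shift `m`:
`C_ss [C_ss + C_vv(m)]⁻¹ y`. -/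
noncomputable def lmmse (M : Mixture Ω) (μ : Measure Ω) (N m : ℕ) (ω : Ω) :
    EuclideanSpace ℂ (Fin N) :=
  WithLp.toLp 2 ((M.Css μ N * (M.Css μ N + M.Cvv μ N m)⁻¹) *ᵥ (M.yVec N ω).ofLp)

/-- The MMSE estimator `E[s | y]`. -/
noncomputable def mmse (M : Mixture Ω) (μ : Measure Ω) (N : ℕ) : Ω → EuclideanSpace ℂ (Fin N) :=
  μ[M.sVec N | M.obs N]

/-- The posterior probability `P(kb = m | y)`. -/
noncomputable def posterior (M : Mixture Ω) (μ : Measure Ω) (N m : ℕ) : Ω → ℝ :=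
  μ⟦M.kb ⁻¹' {m} | M.obs N⟧

/-- `k` is a MAP estimator of `kb` from the observation of length `N`: a function of the
observation that maximizes the posterior probability (ties are broken arbitrarily). -/
structure IsMAP (M : Mixture Ω) (μ : Measure Ω) (N : ℕ) (k : Ω → ℕ) : Prop where
  measurable : Measurable[M.obs N] k
  argmax : ∀ᵐ ω ∂μ, k ω ∈ Finset.Icc 1 M.Kb ∧
    ∀ m ∈ Finset.Icc 1 M.Kb, M.posterior μ N m ω ≤ M.posterior μ N (k ω) ω

/-- Mean squared error of the MMSE estimator. -/
noncomputable def mmseError (M : Mixture Ω) (μ : Measure Ω) (N : ℕ) : ℝ :=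
  ∫ ω, ‖M.mmse μ N ω - M.sVec N ω‖ ^ 2 ∂μ

/-- Mean squared error of the plug-in estimator `lmmse (k)`, for an estimate `k` of the shift. -/
noncomputable def qlmmseError (M : Mixture Ω) (μ : Measure Ω) (N : ℕ) (k : Ω → ℕ) : ℝ :=
  ∫ ω, ‖M.lmmse μ N (k ω) ω - M.sVec N ω‖ ^ 2 ∂μ

end Mixture

/-!
The two-step estimator is compared with the *oracle* `lmmse (kb)`, the linear estimator that is told
the true shift.

*The shift is eventually identified.* On `kb = k` the observation is a proper Gaussian vector with
covariance `C_yy(k)`, so `yᴴ C_yy(k)⁻¹ y` is a sum of `N` independent exponential variables; a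
Chernoff bound and the Borel–Cantelli lemma give `ψ_N(y, kb) → 0` almost surely
(`Mixture.IsGaussianModel.tendsto_ψ_kb`). Under unique detectability the event `ψ_N(y, k) → 0`,
which depends on the whole observation only, therefore coincides almost surely with `kb = k`. Lévy's
upward theorem shows that the posterior probability of `k` tends to the indicator of `kb = k`
(`tendsto_posterior`), and hence that the error probability of the MAP estimator tends to zero
(`tendsto_measureReal_map_ne_kb`). No quantitative form of detectability is needed.

*The excess error is `o(N)`.* Given `kb = m`, the error of the oracle is independent of the
observation, being jointly proper Gaussian and uncorrelated with it. Hence the mean squared error of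
any estimator is the error of the oracle plus the mean squared distance to the oracle
(`integral_norm_sub_sVec_sq`). For the two-step estimator that distance vanishes unless the shift is
misidentified, and the linear estimators have uniformly bounded operator norms because
`C_ss ≤ Λ` and `C_yy(m) ≥ ρSNR⁻¹`. Since the coordinates of `y` have uniformly bounded fourth
moments, the distance is `o(N)` (`integral_norm_lmmse_sub_oracle_sq_le`).

*The oracle error is at least linear in `N`.* The white noise prevents linear estimators from
recovering more than a fixed fraction of the power of the signal (`le_oracle_error`).

The MMSE lies between the error of the oracle and that of the two-step estimator, so the ratio of
the errors tends to one.
-/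

section properGaussian

variable {Ω : Type*} [MeasurableSpace Ω] {μ : Measure Ω}

/-! ### Square-integrable complex families and their covariance matrices -/

/-- The (cross-)covariance matrix `E[X Zᴴ]` of two zero-mean complex families. -/
noncomputable def covMat {ι κ : Type*} (X : ι → Ω → ℂ) (Z : κ → Ω → ℂ) (μ : Measure Ω) :
    Matrix ι κ ℂ :=
  Matrix.of fun i j => ∫ ω, X i ω * star (Z j ω) ∂μ

/-- A complex matrix acting on a finite family of random variables. -/
noncomputable def linImage {Ω ι κ : Type*} [Fintype κ] (A : Matrix ι κ ℂ) (X : κ → Ω → ℂ) :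
    ι → Ω → ℂ :=
  fun i ω => (A *ᵥ fun k => X k ω) i

lemma linImage_apply {Ω ι κ : Type*} [Fintype κ] (A : Matrix ι κ ℂ) (X : κ → Ω → ℂ) (i : ι)
    (ω : Ω) : linImage A X i ω = ∑ k, A i k * X k ω := rfl

lemma memLp_two_of_mem_span {T : Type*} {X : T → Ω → ℂ} (hX : ∀ t, MemLp (X t) 2 μ)
    {Y : Ω → ℂ} (hY : Y ∈ Submodule.span ℂ (Set.range X)) : MemLp Y 2 μ := by
  induction hY using Submodule.span_induction with
  | mem x h => obtain ⟨t, rfl⟩ := h; exact hX t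
  | zero => exact MemLp.zero
  | add x y _ _ hx hy => exact hx.add hy
  | smul a x _ hx => exact hx.const_smul a

lemma MeasureTheory.MemLp.integrable_mul_star {X Z : Ω → ℂ} (hX : MemLp X 2 μ)
    (hZ : MemLp Z 2 μ) : Integrable (fun ω => X ω * star (Z ω)) μ :=
  hX.integrable_mul hZ.star

lemma integral_mul_star_eq_zero_of_mem_span {S T : Type*} {X : S → Ω → ℂ} {Z : T → Ω → ℂ}
    (hX : ∀ t, MemLp (X t) 2 μ) (hZ : ∀ t, MemLp (Z t) 2 μ)
    (h : ∀ s t, ∫ ω, X s ω * star (Z t ω) ∂μ = 0) {x z : Ω → ℂ}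
    (hx : x ∈ Submodule.span ℂ (Set.range X)) (hz : z ∈ Submodule.span ℂ (Set.range Z)) :
    ∫ ω, x ω * star (z ω) ∂μ = 0 := by
  induction hx using Submodule.span_induction with
  | mem x hx =>
    obtain ⟨s, rfl⟩ := hx
    induction hz using Submodule.span_induction with
    | mem z hz => obtain ⟨t, rfl⟩ := hz; exact h s t
    | zero => simp
    | add z z' hz hz' h1 h2 =>
      simp only [Pi.add_apply, star_add, mul_add]
      rw [integral_add, h1, h2, add_zero]
      · exact (hX s).integrable_mul_star (memLp_two_of_mem_span hZ hz)
      · exact (hX s).integrable_mul_star (memLp_two_of_mem_span hZ hz')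
    | smul a z hz h1 =>
      simp only [Pi.smul_apply, smul_eq_mul, star_mul']
      simp_rw [mul_left_comm _ (star a)]
      rw [integral_const_mul, h1, mul_zero]
  | zero => simp
  | add x x' hx hx' h1 h2 =>
    simp only [Pi.add_apply, add_mul]
    rw [integral_add, h1, h2, add_zero]
    · exact (memLp_two_of_mem_span hX hx).integrable_mul_star (memLp_two_of_mem_span hZ hz)
    · exact (memLp_two_of_mem_span hX hx').integrable_mul_star (memLp_two_of_mem_span hZ hz)
  | smul a x hx h1 =>
    simp only [Pi.smul_apply, smul_eq_mul, mul_assoc]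
    rw [integral_const_mul, h1, mul_zero]

/-- Pythagoras' identity in the `L²` space of complex random variables. -/
lemma integral_norm_add_sq_of_orthogonal {X Z : Ω → ℂ} (hX : MemLp X 2 μ) (hZ : MemLp Z 2 μ)
    (h : ∫ ω, X ω * star (Z ω) ∂μ = 0) :
    ∫ ω, ‖X ω + Z ω‖ ^ 2 ∂μ = ∫ ω, ‖X ω‖ ^ 2 ∂μ + ∫ ω, ‖Z ω‖ ^ 2 ∂μ := by
  have e : ∀ ω, ‖X ω + Z ω‖ ^ 2 = ‖X ω‖ ^ 2 + ‖Z ω‖ ^ 2 + 2 * (X ω * star (Z ω)).re := by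
    intro ω
    simp only [Complex.sq_norm]
    exact Complex.normSq_add _ _
  simp_rw [e]
  have hr : ∫ ω, (X ω * star (Z ω)).re ∂μ = 0 := by
    have := integral_re (hX.integrable_mul_star hZ)
    rw [h] at this
    simpa using this
  have i1 : Integrable (fun ω => ‖X ω‖ ^ 2) μ := hX.integrable_norm_pow (by norm_num)
  have i2 : Integrable (fun ω => ‖Z ω‖ ^ 2) μ := hZ.integrable_norm_pow (by norm_num)
  have i3 : Integrable (fun ω => 2 * (X ω * star (Z ω)).re) μ :=
    (hX.integrable_mul_star hZ).re.const_mul 2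
  rw [integral_add (f := fun ω => ‖X ω‖ ^ 2 + ‖Z ω‖ ^ 2) (i1.add i2) i3, integral_add i1 i2,
    integral_const_mul, hr, mul_zero, add_zero]

section covMat

variable {ι κ ι' κ' : Type*} [Fintype ι] [Fintype κ]

lemma linImage_mem_span {Ω ι ι' : Type*} [Fintype ι] (A : Matrix ι' ι ℂ) (X : ι → Ω → ℂ) (i : ι') :
    linImage A X i ∈ Submodule.span ℂ (Set.range X) := by
  have : linImage A X i = ∑ k, A i k • X k := by
    ext ω; simp [linImage_apply]
  rw [this]
  exact Submodule.sum_mem _ fun k _ => Submodule.smul_mem _ _ (Submodule.subset_span ⟨k, rfl⟩)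

lemma memLp_linImage {X : ι → Ω → ℂ} (hX : ∀ i, MemLp (X i) 2 μ) (A : Matrix ι' ι ℂ) (i : ι') :
    MemLp (linImage A X i) 2 μ :=
  memLp_two_of_mem_span hX (linImage_mem_span A X i)

lemma covMat_linImage {X : ι → Ω → ℂ} {Z : κ → Ω → ℂ} (hX : ∀ i, MemLp (X i) 2 μ)
    (hZ : ∀ i, MemLp (Z i) 2 μ) (A : Matrix ι' ι ℂ) (B : Matrix κ' κ ℂ) :
    covMat (linImage A X) (linImage B Z) μ = A * covMat X Z μ * Bᴴ := by
  ext i j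
  have e : ∀ ω, linImage A X i ω * star (linImage B Z j ω)
      = ∑ l, ∑ k, A i k * star (B j l) * (X k ω * star (Z l ω)) := by
    intro ω
    rw [linImage_apply, linImage_apply, star_sum, Finset.sum_mul_sum, Finset.sum_comm]
    refine Finset.sum_congr rfl fun l _ => Finset.sum_congr rfl fun k _ => ?_
    rw [star_mul']; ring
  simp only [covMat, Matrix.of_apply, e]
  have hi : ∀ l k, Integrable (fun ω => A i k * star (B j l) * (X k ω * star (Z l ω))) μ :=
    fun l k => ((hX k).integrable_mul_star (hZ l)).const_mul _
  rw [integral_finsetSum _ fun l _ => integrable_finsetSum _ fun k _ => hi l k]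
  simp_rw [integral_finsetSum _ fun k _ => hi _ k, integral_const_mul]
  simp only [Matrix.mul_apply, Matrix.of_apply, Matrix.conjTranspose_apply, Finset.sum_mul]
  refine Finset.sum_congr rfl fun l _ => Finset.sum_congr rfl fun k _ => ?_
  ring

lemma covMat_conjTranspose (X : ι' → Ω → ℂ) (Z : κ' → Ω → ℂ) :
    (covMat X Z μ)ᴴ = covMat Z X μ := by
  ext i j
  simp only [covMat, Matrix.conjTranspose_apply, Matrix.of_apply]
  rw [← starRingEnd_apply, ← integral_conj]
  simp [mul_comm]

/-- The quadratic form of a covariance matrix is a mean square. -/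
lemma star_dotProduct_covMat_mulVec {X : ι → Ω → ℂ} (hX : ∀ i, MemLp (X i) 2 μ) (x : ι → ℂ) :
    star x ⬝ᵥ (covMat X X μ *ᵥ x) = ((∫ ω, ‖∑ i, star (x i) * X i ω‖ ^ 2 ∂μ : ℝ) : ℂ) := by
  have h := covMat_linImage hX hX (Matrix.of fun (_ : Unit) i => star (x i))
    (Matrix.of fun (_ : Unit) i => star (x i))
  have h2 := congrFun (congrFun h ()) ()
  have e : (Matrix.of fun (_ : Unit) i => star (x i)) * covMat X X μ
      * (Matrix.of fun (_ : Unit) i => star (x i))ᴴ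
      = Matrix.of fun _ _ => star x ⬝ᵥ (covMat X X μ *ᵥ x) := by
    rw [Matrix.mul_assoc]
    ext a b
    simp [Matrix.mul_apply, dotProduct, Matrix.mulVec]
  rw [e] at h2
  simp only [covMat, Matrix.of_apply] at h2 ⊢
  rw [← h2, ← integral_complex_ofReal]
  refine integral_congr_ae (.of_forall fun ω => ?_)
  simp only [linImage_apply, Matrix.of_apply]
  rw [← starRingEnd_apply, Complex.mul_conj, Complex.normSq_eq_norm_sq]

lemma covMat_self_isHermitian (X : ι' → Ω → ℂ) : (covMat X X μ).IsHermitian :=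
  covMat_conjTranspose X X

end covMat

/-! ### Proper Gaussian families -/

/-- A zero-mean proper (circularly-symmetric) complex Gaussian family over an arbitrary index
type: jointly Gaussian, centred, and with vanishing pseudo-covariances `E[X s * X t]`. -/
structure IsProperGaussian {T : Type*} (X : T → Ω → ℂ) (μ : Measure Ω) : Prop where
  measurable : ∀ t, Measurable (X t)
  gaussian : IsGaussianProcess X μ
  mean_zero : ∀ t, ∫ ω, X t ω ∂μ = 0
  pseudoCov_zero : ∀ s t, ∫ ω, X s ω * X t ω ∂μ = 0

namespace IsProperGaussian

variable {S T : Type*} {X : T → Ω → ℂ}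

lemma memLp (hX : IsProperGaussian X μ) (t : T) : MemLp (X t) 2 μ :=
  (hX.gaussian.hasGaussianLaw_eval t).memLp_two

lemma of_mem_span (hX : IsProperGaussian X μ) {Y : S → Ω → ℂ}
    (hY : ∀ s, Y s ∈ Submodule.span ℂ (Set.range X)) : IsProperGaussian Y μ := by
  have hL := hX.memLp
  refine ⟨fun s => ?_, ?_, fun s => ?_, fun s t => ?_⟩
  · have hYs := hY s
    generalize Y s = y at hYs ⊢
    induction hYs using Submodule.span_induction with
    | mem x h => obtain ⟨t, rfl⟩ := h; exact hX.measurable t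
    | zero => exact measurable_zero
    | add x y _ _ hx hy => exact hx.add hy
    | smul a x _ hx => exact hx.const_smul a
  · refine hX.gaussian.of_isGaussianProcess fun s => ?_
    obtain ⟨c, hc⟩ := Finsupp.mem_span_range_iff_exists_finsupp.1 (hY s)
    refine ⟨c.support, ∑ i, c i.1 • ContinuousLinearMap.proj (R := ℝ) i, fun ω => ?_⟩
    rw [← hc]
    simp only [Finsupp.sum, _root_.sum_apply, _root_.smul_apply,
      ContinuousLinearMap.proj_apply, Finset.sum_apply, Pi.smul_apply, Finset.restrict]
    exact (Finset.sum_coe_sort c.support fun i => c i • X i ω).symm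
  · have hYs := hY s
    generalize Y s = y at hYs ⊢
    induction hYs using Submodule.span_induction with
    | mem x h => obtain ⟨t, rfl⟩ := h; exact hX.mean_zero t
    | zero => simp
    | add x y hx hy h1 h2 =>
      have := hX.gaussian.isProbabilityMeasure
      simp only [Pi.add_apply]
      rw [integral_add ((memLp_two_of_mem_span hL hx).integrable (by norm_num))
        ((memLp_two_of_mem_span hL hy).integrable (by norm_num)), h1, h2, add_zero]
    | smul a x _ hx => simp only [Pi.smul_apply, smul_eq_mul]; rw [integral_const_mul, hx, mul_zero]
  · -- the pseudo-covariance with `Y t` is the covariance with the conjugate family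
    have h := integral_mul_star_eq_zero_of_mem_span (μ := μ) (X := X) (Z := fun t ω => star (X t ω))
      hL (fun t => (hL t).star) (fun s t => by simpa using hX.pseudoCov_zero s t) (hY s)
      (z := fun ω => star (Y t ω)) ?_
    · simpa using h
    · have hYt := hY t
      generalize Y t = y at hYt ⊢
      induction hYt using Submodule.span_induction with
      | mem x h => obtain ⟨t, rfl⟩ := h; exact Submodule.subset_span ⟨t, rfl⟩
      | zero => simp only [Pi.zero_apply, star_zero]; exact Submodule.zero_mem _
      | add x y _ _ hx hy =>
        simp only [Pi.add_apply, star_add]; exact Submodule.add_mem _ hx hy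
      | smul a x _ hx =>
        simp only [Pi.smul_apply, smul_eq_mul, star_mul']
        exact Submodule.smul_mem _ (star a) hx

lemma linImage {ι κ : Type*} [Fintype κ] {X : κ → Ω → ℂ} (hX : IsProperGaussian X μ)
    (A : Matrix ι κ ℂ) : IsProperGaussian (linImage A X) μ :=
  hX.of_mem_span (linImage_mem_span A X)

/-- When the pseudo-covariance vanishes, the covariance of two real-linear functionals is half the
real part of the complex covariance. -/
lemma integral_re_mul_re {X Z : Ω → ℂ} (hX : MemLp X 2 μ) (hZ : MemLp Z 2 μ)
    (h0 : ∫ ω, X ω * Z ω ∂μ = 0) (u v : ℂ) :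
    ∫ ω, (u * X ω).re * (v * Z ω).re ∂μ = (u * star v * ∫ ω, X ω * star (Z ω) ∂μ).re / 2 := by
  have e : ∀ ω, (u * X ω).re * (v * Z ω).re
      = ((u * v * (X ω * Z ω)).re + (u * star v * (X ω * star (Z ω))).re) / 2 := by
    intro ω
    simp only [Complex.mul_re, Complex.mul_im, Complex.star_def, Complex.conj_re, Complex.conj_im]
    ring
  have i1 : Integrable (fun ω => u * v * (X ω * Z ω)) μ := (hX.integrable_mul hZ).const_mul _
  have i2 : Integrable (fun ω => u * star v * (X ω * star (Z ω))) μ :=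
    (hX.integrable_mul_star hZ).const_mul _
  have r1 := integral_re i1
  have r2 := integral_re i2
  simp only [RCLike.re_to_complex] at r1 r2
  have j1 : Integrable (fun ω => (u * v * (X ω * Z ω)).re) μ := i1.re
  have j2 : Integrable (fun ω => (u * star v * (X ω * star (Z ω))).re) μ := i2.re
  simp_rw [e]
  rw [integral_div, integral_add j1 j2, r1, r2,
    integral_const_mul, integral_const_mul, h0]
  simp

/-- Two subfamilies of a proper Gaussian family that are uncorrelated are independent: properness
turns vanishing complex covariances into vanishing covariances of all real and imaginary parts. -/
lemma indepFun_of_covMat_eq_zero {X : S → Ω → ℂ} {Z : T → Ω → ℂ}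
    (h : IsProperGaussian (Sum.elim X Z) μ)
    (h0 : ∀ s t, ∫ ω, X s ω * star (Z t ω) ∂μ = 0) :
    IndepFun (fun ω s => X s ω) (fun ω t => Z t ω) μ := by
  have := h.gaussian.isProbabilityMeasure
  refine h.gaussian.indepFun_of_covariance_inner
    (fun s => (h.measurable (.inl s)).aemeasurable)
    (fun t => (h.measurable (.inr t)).aemeasurable) fun s t x y => ?_
  have hX : MemLp (X s) 2 μ := h.memLp (.inl s)
  have hZ : MemLp (Z t) 2 μ := h.memLp (.inr t)
  have mX : ∫ ω, X s ω ∂μ = 0 := h.mean_zero (.inl s)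
  have e : ∀ (x : ℂ) (X : Ω → ℂ), (fun ω => inner ℝ x (X ω)) = fun ω => (star x * X ω).re := by
    intro x X; ext ω; rw [Complex.inner, mul_comm]; rfl
  have m0 : ∫ ω, (star x * X s ω).re ∂μ = 0 := by
    have := integral_re (((hX.integrable (by norm_num)).const_mul (star x)))
    simp only [RCLike.re_to_complex] at this
    rw [this, integral_const_mul, mX]; simp
  rw [e, e, covariance_eq_sub]
  · simp only [Pi.mul_apply]
    rw [m0, integral_re_mul_re hX hZ (h.pseudoCov_zero (.inl s) (.inr t)), h0]
    simp
  · exact (hX.const_mul (star x)).re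
  · exact (hZ.const_mul (star y)).re

end IsProperGaussian

/-! ### Squares of Gaussian variables -/

lemma integral_exp_mul_sq_gaussianReal {v : NNReal} (hv : v ≠ 0) {t : ℝ} (ht : 2 * v * t < 1) :
    ∫ x, Real.exp (t * x ^ 2) ∂(gaussianReal 0 v) = (√(1 - 2 * v * t))⁻¹ := by
  have hv' : (0 : ℝ) < v := by positivity
  rw [integral_gaussianReal_eq_integral_smul hv]
  have e : ∀ x : ℝ, gaussianPDFReal 0 v x • Real.exp (t * x ^ 2)
      = (√(2 * Real.pi * v))⁻¹ * Real.exp (-((1 - 2 * v * t) / (2 * v)) * x ^ 2) := by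
    intro x
    rw [gaussianPDFReal_def, smul_eq_mul, mul_assoc, ← Real.exp_add]
    congr 2
    field_simp
    ring
  simp_rw [e]
  rw [integral_const_mul, integral_gaussian, ← Real.sqrt_inv, ← Real.sqrt_inv, ← Real.sqrt_mul]
  · congr 1
    have := Real.pi_pos
    have : (1 - 2 * v * t) ≠ 0 := by linarith
    field_simp
  · positivity

lemma integrable_exp_mul_sq_gaussianReal {v : NNReal} (hv : v ≠ 0) {t : ℝ} (ht : 2 * v * t < 1) :
    Integrable (fun x => Real.exp (t * x ^ 2)) (gaussianReal 0 v) := by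
  by_contra h
  have h1 := integral_exp_mul_sq_gaussianReal hv ht
  rw [integral_undef h] at h1
  have : 0 < √(1 - 2 * v * t) := Real.sqrt_pos.2 (by linarith)
  exact (inv_pos.2 this).ne h1

/-- Fourth moments of a centred Gaussian variable are controlled by its variance; the constant is
not optimal, it comes from `u ^ 2 / 2 ≤ exp u`. -/
lemma integral_pow_four_le_of_hasGaussianLaw {X : Ω → ℝ} (hX : HasGaussianLaw X μ)
    (h0 : ∫ ω, X ω ∂μ = 0) : ∫ ω, X ω ^ 4 ∂μ ≤ 64 * (∫ ω, X ω ^ 2 ∂μ) ^ 2 := by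
  have hlaw := hX.map_eq_gaussianReal
  have hvar : Var[X; μ] = ∫ ω, X ω ^ 2 ∂μ := variance_of_integral_eq_zero hX.aemeasurable h0
  rw [h0] at hlaw
  have hmap : ∫ ω, X ω ^ 4 ∂μ = ∫ x, x ^ 4 ∂(gaussianReal 0 Var[X; μ].toNNReal) := by
    rw [← hlaw, integral_map hX.aemeasurable (by fun_prop)]
  rw [hmap, ← hvar]
  set v := Var[X; μ].toNNReal with hvdef
  have hvv : Var[X; μ] = v := by rw [hvdef, Real.coe_toNNReal _ (variance_nonneg _ _)]
  rw [hvv]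
  by_cases hv : v = 0
  · simp [hv]
  have hv' : (0 : ℝ) < v := by positivity
  have ht : 2 * (v : ℝ) * (1 / (4 * v)) < 1 := by
    field_simp; norm_num
  have hle : ∀ x : ℝ, x ^ 4 ≤ 32 * (v : ℝ) ^ 2 * Real.exp (1 / (4 * v) * x ^ 2) := by
    intro x
    have h1 := Real.quadratic_le_exp_of_nonneg (x := 1 / (4 * v) * x ^ 2) (by positivity)
    have h2 : 0 ≤ 1 / (4 * v) * x ^ 2 := by positivity
    have h3 : x ^ 4 = 32 * (v : ℝ) ^ 2 * ((1 / (4 * v) * x ^ 2) ^ 2 / 2) := by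
      field_simp; ring
    rw [h3]
    gcongr
    linarith
  calc ∫ x, x ^ 4 ∂(gaussianReal 0 v)
      ≤ ∫ x, 32 * (v : ℝ) ^ 2 * Real.exp (1 / (4 * v) * x ^ 2) ∂(gaussianReal 0 v) := by
        refine integral_mono_of_nonneg (.of_forall fun x => by positivity)
          ((integrable_exp_mul_sq_gaussianReal hv ht).const_mul _) (.of_forall hle)
    _ = 32 * (v : ℝ) ^ 2 * (√(1 / 2))⁻¹ := by
        rw [integral_const_mul, integral_exp_mul_sq_gaussianReal hv ht]
        congr 4
        field_simp; norm_num
    _ ≤ 32 * (v : ℝ) ^ 2 * 2 := by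
        gcongr
        rw [inv_le_comm₀ (by positivity) (by norm_num)]
        exact Real.le_sqrt_of_sq_le (by norm_num)
    _ = 64 * (v : ℝ) ^ 2 := by ring

namespace IsProperGaussian

lemma integral_norm_pow_four_le {T : Type*} {X : T → Ω → ℂ} (hX : IsProperGaussian X μ) (t : T) :
    ∫ ω, ‖X t ω‖ ^ 4 ∂μ ≤ 256 * (∫ ω, ‖X t ω‖ ^ 2 ∂μ) ^ 2 := by
  have := hX.gaussian.isProbabilityMeasure
  have hg := hX.gaussian.hasGaussianLaw_eval t
  have hL : MemLp (X t) 4 μ := hg.memLp (by norm_num)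
  have hL2 := hX.memLp t
  have hre : HasGaussianLaw (fun ω => (X t ω).re) μ := hg.map_fun Complex.reCLM
  have him : HasGaussianLaw (fun ω => (X t ω).im) μ := hg.map_fun Complex.imCLM
  have hi : Integrable (X t) μ := hg.integrable
  have mre : ∫ ω, (X t ω).re ∂μ = 0 := by
    have := integral_re hi
    simp only [RCLike.re_to_complex] at this
    rw [this, hX.mean_zero]; simp
  have mim : ∫ ω, (X t ω).im ∂μ = 0 := by
    have := integral_im hi
    simp only [RCLike.im_to_complex] at this
    rw [this, hX.mean_zero]; simp
  have i4 : ∀ {Y : Ω → ℝ}, HasGaussianLaw Y μ → Integrable (fun ω => Y ω ^ 4) μ := fun hY => by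
    have := (hY.memLp (p := 4) (by norm_num)).integrable_norm_pow (by norm_num)
    refine this.congr (.of_forall fun ω => ?_)
    simp only [Real.norm_eq_abs]
    exact Even.pow_abs (by decide) _
  have i2 : Integrable (fun ω => ‖X t ω‖ ^ 2) μ := hL2.integrable_norm_pow (by norm_num)
  have b1 := integral_pow_four_le_of_hasGaussianLaw hre mre
  have b2 := integral_pow_four_le_of_hasGaussianLaw him mim
  have c1 : ∫ ω, (X t ω).re ^ 2 ∂μ ≤ ∫ ω, ‖X t ω‖ ^ 2 ∂μ := by
    refine integral_mono_of_nonneg (.of_forall fun ω => by positivity) i2 (.of_forall fun ω => ?_)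
    simp only [Complex.sq_norm, Complex.normSq_apply]
    nlinarith [sq_nonneg (X t ω).im]
  have c2 : ∫ ω, (X t ω).im ^ 2 ∂μ ≤ ∫ ω, ‖X t ω‖ ^ 2 ∂μ := by
    refine integral_mono_of_nonneg (.of_forall fun ω => by positivity) i2 (.of_forall fun ω => ?_)
    simp only [Complex.sq_norm, Complex.normSq_apply]
    nlinarith [sq_nonneg (X t ω).re]
  have d1 : 0 ≤ ∫ ω, (X t ω).re ^ 2 ∂μ := integral_nonneg fun ω => by positivity
  have d2 : 0 ≤ ∫ ω, (X t ω).im ^ 2 ∂μ := integral_nonneg fun ω => by positivity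
  calc ∫ ω, ‖X t ω‖ ^ 4 ∂μ ≤ ∫ ω, (2 * (X t ω).re ^ 4 + 2 * (X t ω).im ^ 4) ∂μ := by
        refine integral_mono_of_nonneg (.of_forall fun ω => by positivity)
          (((i4 hre).const_mul 2).add ((i4 him).const_mul 2)) (.of_forall fun ω => ?_)
        have : ‖X t ω‖ ^ 4 = ((X t ω).re ^ 2 + (X t ω).im ^ 2) ^ 2 := by
          rw [show ‖X t ω‖ ^ 4 = (‖X t ω‖ ^ 2) ^ 2 by ring, Complex.sq_norm, Complex.normSq_apply]
          ring
        simp only [this]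
        nlinarith [sq_nonneg ((X t ω).re ^ 2 - (X t ω).im ^ 2)]
    _ = 2 * ∫ ω, (X t ω).re ^ 4 ∂μ + 2 * ∫ ω, (X t ω).im ^ 4 ∂μ := by
        rw [integral_add ((i4 hre).const_mul 2) ((i4 him).const_mul 2), integral_const_mul,
          integral_const_mul]
    _ ≤ 256 * (∫ ω, ‖X t ω‖ ^ 2 ∂μ) ^ 2 := by
        have e1 := pow_le_pow_left₀ d1 c1 2
        have e2 := pow_le_pow_left₀ d2 c2 2
        linarith

end IsProperGaussian

/-! ### Concentration of Gaussian quadratic forms -/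

/-- The Chernoff bound for the mean of `n` exponential variables to deviate beyond the level `1 + u`
is `((1 + u) * exp (-u)) ^ n`; it decays for deviations `u` of either sign. -/
lemma one_add_mul_exp_neg_lt_one {u : ℝ} (hu : u ≠ 0) : (1 + u) * Real.exp (-u) < 1 := by
  rw [Real.exp_neg, ← div_eq_mul_inv, div_lt_one (Real.exp_pos _), add_comm]
  exact Real.add_one_lt_exp hu

section Chernoff

variable {ι : Type*} [Fintype ι] {g : ι × Fin 2 → Ω → ℝ}

lemma mgf_sum_sq (hm : ∀ p, Measurable (g p)) (hg : iIndepFun g μ)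
    (hlaw : ∀ p, μ.map (g p) = gaussianReal 0 (1 / 2)) {t : ℝ} (ht : t < 1) :
    Integrable (fun ω => Real.exp (t * ∑ p, g p ω ^ 2)) μ ∧
      mgf (fun ω => ∑ p, g p ω ^ 2) μ t = ((1 - t)⁻¹) ^ Fintype.card ι := by
  have ht' : 2 * ((1 / 2 : NNReal) : ℝ) * t < 1 := by simpa using ht
  have := hg.isProbabilityMeasure
  have hind : iIndepFun (fun p ω => g p ω ^ 2) μ :=
    hg.comp (fun _ x => x ^ 2) (fun _ => by fun_prop)
  have hint : ∀ p, Integrable (fun ω => Real.exp (t * g p ω ^ 2)) μ := fun p => by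
    have := integrable_exp_mul_sq_gaussianReal (v := 1 / 2) (by simp) ht'
    rw [← hlaw p] at this
    exact this.comp_measurable (hm p)
  have hmgf : ∀ p, mgf (fun ω => g p ω ^ 2) μ t = (√(1 - t))⁻¹ := fun p => by
    have h := integral_exp_mul_sq_gaussianReal (v := 1 / 2) (by simp) ht'
    rw [← hlaw p, integral_map (hm p).aemeasurable (by fun_prop)] at h
    rw [mgf, h]
    simp
  constructor
  · have := hind.integrable_exp_mul_sum (t := t) (fun p => by fun_prop) (s := Finset.univ)
      (fun p _ => hint p)
    simpa using this
  · have h := hind.mgf_sum (t := t) (fun p => by fun_prop) Finset.univ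
    have e : (∑ p, fun ω => g p ω ^ 2) = fun ω => ∑ p, g p ω ^ 2 := by ext; simp
    rw [e] at h
    rw [h]
    simp only [hmgf, Finset.prod_const, Finset.card_univ, Fintype.card_prod, Fintype.card_fin]
    rw [mul_comm, pow_mul, inv_pow, Real.sq_sqrt (by linarith)]

/-- Chernoff bound, in both directions, for a sum of squares of independent `N(0, 1/2)` variables
(a Gamma variable of shape `card ι`): deviations of the mean by `ε` are exponentially unlikely. -/
lemma measureReal_le_abs_sum_sq_sub_le (hm : ∀ p, Measurable (g p)) (hg : iIndepFun g μ)
    (hlaw : ∀ p, μ.map (g p) = gaussianReal 0 (1 / 2)) {ε : ℝ} (h0 : 0 < ε) (h1 : ε < 1) :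
    μ.real {ω | Fintype.card ι * ε ≤ |∑ p, g p ω ^ 2 - Fintype.card ι|}
      ≤ ((1 + ε) * Real.exp (-ε)) ^ Fintype.card ι
        + ((1 + -ε) * Real.exp (- -ε)) ^ Fintype.card ι := by
  have := hg.isProbabilityMeasure
  set n := Fintype.card ι
  -- the optimal exponent for the level `n * (1 + u)` is `t = u / (1 + u)`
  have key : ∀ u : ℝ, -1 < u → Real.exp (-(u / (1 + u)) * (n * (1 + u))) *
      ((1 - u / (1 + u))⁻¹) ^ n = ((1 + u) * Real.exp (-u)) ^ n := by
    intro u hu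
    have hu' : 1 + u ≠ 0 := by linarith
    have e1 : 1 - u / (1 + u) = (1 + u)⁻¹ := by field_simp; ring
    have e2 : -(u / (1 + u)) * (n * (1 + u)) = n * (-u) := by field_simp
    rw [e1, inv_inv, e2, Real.exp_nat_mul, mul_pow, mul_comm]
  have ht : ∀ u : ℝ, -1 < u → u / (1 + u) < 1 := fun u hu => by
    rw [div_lt_one (by linarith)]; linarith
  have hu := ht ε (by linarith)
  have hl := ht (-ε) (by linarith)
  obtain ⟨iu, mu⟩ := mgf_sum_sq hm hg hlaw hu
  obtain ⟨il, ml⟩ := mgf_sum_sq hm hg hlaw hl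
  have bu := measure_ge_le_exp_mul_mgf (n * (1 + ε)) (by positivity) iu
  have bl := measure_le_le_exp_mul_mgf (n * (1 + -ε))
    (div_nonpos_of_nonpos_of_nonneg (by linarith) (by linarith)) il
  rw [mu, key _ (by linarith)] at bu
  rw [ml, key _ (by linarith)] at bl
  refine le_trans (measureReal_mono ?_) ((measureReal_union_le _ _).trans (add_le_add bu bl))
  intro ω hω
  simp only [Set.mem_ofPred_eq, Set.mem_union] at hω ⊢
  rcases le_abs.1 hω with h | h
  · left; linarith
  · right; linarith

end Chernoff

open scoped ComplexOrder MatrixOrder in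
lemma Matrix.PosSemidef.exists_eq_conjTranspose_mul_self {n : Type*} [Fintype n]
    {C : Matrix n n ℂ} (hC : C.PosSemidef) : ∃ B : Matrix n n ℂ, C = Bᴴ * B := by
  classical
  exact CStarAlgebra.nonneg_iff_eq_star_mul_self.1 hC.nonneg

namespace IsProperGaussian

open scoped ComplexOrder

/-- A proper Gaussian family with identity covariance has independent `N(0, 1/2)` real and
imaginary parts, written uniformly as `re (1 * Z)` and `re (-I * Z)`. -/
lemma iIndepFun_re_im {ι : Type*} [Fintype ι] [DecidableEq ι] {Z : ι → Ω → ℂ}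
    (hZ : IsProperGaussian Z μ) (hC : covMat Z Z μ = 1) :
    iIndepFun (fun (p : ι × Fin 2) ω => (![(1 : ℂ), -Complex.I] p.2 * Z p.1 ω).re) μ ∧
      ∀ p : ι × Fin 2, μ.map (fun ω => (![(1 : ℂ), -Complex.I] p.2 * Z p.1 ω).re)
        = gaussianReal 0 (1 / 2) := by
  have := hZ.gaussian.isProbabilityMeasure
  set u : Fin 2 → ℂ := ![(1 : ℂ), -Complex.I] with hu
  have hproc : IsGaussianProcess (fun (p : ι × Fin 2) ω => (u p.2 * Z p.1 ω).re) μ := by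
    refine hZ.gaussian.of_isGaussianProcess fun p => ⟨{p.1},
      Complex.reCLM ∘L (u p.2 • ContinuousLinearMap.proj (R := ℝ) ⟨p.1, by simp⟩), fun ω => ?_⟩
    simp
  have hL : ∀ p : ι × Fin 2, MemLp (fun ω => (u p.2 * Z p.1 ω).re) 2 μ := fun p =>
    (hproc.hasGaussianLaw_eval p).memLp_two
  have hmean : ∀ p : ι × Fin 2, ∫ ω, (u p.2 * Z p.1 ω).re ∂μ = 0 := fun p => by
    have := integral_re (((hZ.memLp p.1).integrable (by norm_num)).const_mul (u p.2))
    simp only [RCLike.re_to_complex] at this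
    rw [this, integral_const_mul, hZ.mean_zero]; simp
  have hcov : ∀ p q : ι × Fin 2, cov[fun ω => (u p.2 * Z p.1 ω).re,
      fun ω => (u q.2 * Z q.1 ω).re; μ] = if p = q then 1 / 2 else 0 := by
    intro p q
    rw [covariance_eq_sub (hL p) (hL q)]
    simp only [Pi.mul_apply]
    have hpq := congrFun (congrFun hC p.1) q.1
    simp only [covMat, Matrix.of_apply] at hpq
    rw [hmean, integral_re_mul_re (hZ.memLp _) (hZ.memLp _) (hZ.pseudoCov_zero _ _), hpq,
      Matrix.one_apply]
    obtain ⟨i, a⟩ := p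
    obtain ⟨j, b⟩ := q
    by_cases hij : i = j
    · subst hij
      fin_cases a <;> fin_cases b <;> simp [hu]
    · simp [hij]
  constructor
  · have h := hproc.hasGaussianLaw Finset.univ
    have h' := h.map (ContinuousLinearMap.pi fun p : ι × Fin 2 =>
      ContinuousLinearMap.proj (R := ℝ) (φ := fun _ : (Finset.univ : Finset (ι × Fin 2)) => ℝ)
        ⟨p, Finset.mem_univ p⟩)
    refine HasGaussianLaw.iIndepFun_of_covariance_eq_zero h' fun p q hpq => ?_
    rw [hcov, if_neg hpq]
  · intro p
    have h := (hproc.hasGaussianLaw_eval p).map_eq_gaussianReal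
    have hv : Var[fun ω => (u p.2 * Z p.1 ω).re; μ] = 1 / 2 := by
      rw [← covariance_self (hL p).aemeasurable, hcov, if_pos rfl]
    rw [h, hmean, hv]
    congr 1
    ext
    simp

/-- Concentration of the normalized quadratic form `Xᴴ C⁻¹ X` of a proper Gaussian vector `X` with
covariance `C`: whitening with `C = Bᴴ B` turns it into a sum of independent squares. -/
lemma measureReal_norm_quadForm_sub_le {ι : Type*} [Fintype ι] [DecidableEq ι] {X : ι → Ω → ℂ}
    (hX : IsProperGaussian X μ) (hC : (covMat X X μ).PosDef) {ε : ℝ} (h0 : 0 < ε) (h1 : ε < 1) :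
    μ.real {ω | Fintype.card ι * ε ≤ ‖star (fun i => X i ω) ⬝ᵥ
        ((covMat X X μ)⁻¹ *ᵥ fun i => X i ω) - Fintype.card ι‖}
      ≤ ((1 + ε) * Real.exp (-ε)) ^ Fintype.card ι
        + ((1 + -ε) * Real.exp (- -ε)) ^ Fintype.card ι := by
  obtain ⟨B, hB⟩ := hC.posSemidef.exists_eq_conjTranspose_mul_self
  set C := covMat X X μ with hCdef
  have hdet : IsUnit C.det := (Matrix.isUnit_iff_isUnit_det _).1 hC.isUnit
  have hBdet : IsUnit B.det := by
    rw [hB, Matrix.det_mul] at hdet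
    exact isUnit_of_mul_isUnit_right hdet
  have hBdet' : IsUnit Bᴴ.det := by
    rw [hB, Matrix.det_mul] at hdet
    exact isUnit_of_mul_isUnit_left hdet
  have hZ : IsProperGaussian (_root_.linImage (Bᴴ)⁻¹ X) μ := hX.linImage _
  have hZC : covMat (_root_.linImage (Bᴴ)⁻¹ X) (_root_.linImage (Bᴴ)⁻¹ X) μ = 1 := by
    rw [covMat_linImage hX.memLp hX.memLp, ← hCdef, hB, ← Matrix.mul_assoc,
      Matrix.nonsing_inv_mul _ hBdet', one_mul, Matrix.conjTranspose_nonsing_inv,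
      Matrix.conjTranspose_conjTranspose, Matrix.mul_nonsing_inv _ hBdet]
  obtain ⟨hind, hlaw⟩ := hZ.iIndepFun_re_im hZC
  have hq : ∀ ω, star (fun i => X i ω) ⬝ᵥ (C⁻¹ *ᵥ fun i => X i ω)
      = ((∑ p : ι × Fin 2, (![(1 : ℂ), -Complex.I] p.2 *
        _root_.linImage (Bᴴ)⁻¹ X p.1 ω).re ^ 2 : ℝ) : ℂ) := by
    intro ω
    have e1 : C⁻¹ = ((Bᴴ)⁻¹)ᴴ * (Bᴴ)⁻¹ := by
      rw [hB, Matrix.mul_inv_rev, Matrix.conjTranspose_nonsing_inv,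
        Matrix.conjTranspose_conjTranspose]
    rw [e1, ← Matrix.mulVec_mulVec, Matrix.dotProduct_mulVec, ← Matrix.star_mulVec,
      Fintype.sum_prod_type]
    simp only [dotProduct, Fin.sum_univ_two, Complex.ofReal_sum]
    refine Finset.sum_congr rfl fun i _ => ?_
    change star (_root_.linImage (Bᴴ)⁻¹ X i ω) * _root_.linImage (Bᴴ)⁻¹ X i ω = _
    rw [mul_comm, ← starRingEnd_apply, Complex.mul_conj, Complex.normSq_apply]
    simp
    ring
  have hb := measureReal_le_abs_sum_sq_sub_le (μ := μ) (fun p => by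
    have := hZ.measurable p.1
    fun_prop) hind hlaw h0 h1
  refine le_trans (le_of_eq ?_) hb
  congr 1
  ext ω
  simp only [Set.mem_ofPred_eq, hq]
  rw [← Complex.ofReal_natCast, ← Complex.ofReal_sub, Complex.norm_real, Real.norm_eq_abs]

/-- Law of large numbers for normalized quadratic forms: along any sequence of nondegenerate proper
Gaussian vectors `X N` of dimension `N`, with covariance `C N`, one has
`(X N)ᴴ (C N)⁻¹ (X N) / N → 1` almost surely. -/
lemma tendsto_quadForm {X : (N : ℕ) → Fin N → Ω → ℂ} (hX : ∀ N, IsProperGaussian (X N) μ)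
    (hC : ∀ N, (covMat (X N) (X N) μ).PosDef) :
    ∀ᵐ ω ∂μ, Tendsto (fun N : ℕ => ‖(1 / (N : ℂ)) * (star (fun i => X N i ω) ⬝ᵥ
      ((covMat (X N) (X N) μ)⁻¹ *ᵥ fun i => X N i ω)) - 1‖) atTop (𝓝 0) := by
  have := (hX 0).gaussian.isProbabilityMeasure
  have hev : ∀ k : ℕ, ∀ᵐ ω ∂μ, ∀ᶠ N : ℕ in atTop, ¬ ((N : ℝ) * (1 / ((k : ℝ) + 2)) ≤
      ‖star (fun i => X N i ω) ⬝ᵥ ((covMat (X N) (X N) μ)⁻¹ *ᵥ fun i => X N i ω) - (N : ℂ)‖) := by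
    intro k
    have h0 : (0 : ℝ) < 1 / ((k : ℝ) + 2) := by positivity
    have h1 : 1 / ((k : ℝ) + 2) < 1 := by
      rw [div_lt_one (by positivity)]; linarith [(Nat.cast_nonneg k : (0 : ℝ) ≤ k)]
    set ε := 1 / ((k : ℝ) + 2)
    have hs : Summable fun N : ℕ => ((1 + ε) * Real.exp (-ε)) ^ N
        + ((1 + -ε) * Real.exp (- -ε)) ^ N := by
      refine (summable_geometric_of_lt_one ?_ (one_add_mul_exp_neg_lt_one h0.ne')).add
        (summable_geometric_of_lt_one ?_ (one_add_mul_exp_neg_lt_one (neg_ne_zero.2 h0.ne')))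
      · positivity
      · exact mul_nonneg (by linarith) (Real.exp_pos _).le
    refine ae_eventually_notMem (s := fun N : ℕ => {ω | (N : ℝ) * ε ≤ ‖star (fun i => X N i ω) ⬝ᵥ
      ((covMat (X N) (X N) μ)⁻¹ *ᵥ fun i => X N i ω) - (N : ℂ)‖}) (ne_of_lt ?_)
    refine lt_of_le_of_lt (ENNReal.tsum_le_tsum fun N => ?_) hs.tsum_ofReal_lt_top
    have := (hX N).measureReal_norm_quadForm_sub_le (hC N) h0 h1
    rw [Fintype.card_fin] at this
    rw [← ofReal_measureReal]
    exact ENNReal.ofReal_le_ofReal this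
  filter_upwards [ae_all_iff.2 hev] with ω hω
  rw [Metric.tendsto_atTop]
  intro δ hδ
  obtain ⟨k, hk⟩ := exists_nat_one_div_lt hδ
  obtain ⟨N₀, hN₀⟩ := eventually_atTop.1 (hω k)
  refine ⟨N₀ + 1, fun N hN => ?_⟩
  have h := not_le.1 (hN₀ N (by omega))
  have hN0 : (0 : ℝ) < N := by exact_mod_cast (by omega : 0 < N)
  have hNC : (N : ℂ) ≠ 0 := by exact_mod_cast hN0.ne'
  rw [Real.dist_eq, sub_zero, abs_norm]
  have e : ∀ q : ℂ, ‖(1 / (N : ℂ)) * q - 1‖ = ‖q - N‖ / N := by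
    intro q
    have : (1 / (N : ℂ)) * q - 1 = (q - N) / N := by field_simp
    rw [this, norm_div, Complex.norm_natCast]
  rw [e, div_lt_iff₀ hN0]
  have h2 : 1 / ((k : ℝ) + 2) ≤ 1 / ((k : ℝ) + 1) :=
    one_div_le_one_div_of_le (by positivity) (by linarith)
  nlinarith

end IsProperGaussian

end properGaussian

/-! ### Operator bounds for Hermitian forms -/

section forms

variable {ι : Type*} [Fintype ι]

lemma star_dotProduct_self_eq (x : ι → ℂ) : star x ⬝ᵥ x = ((∑ i, ‖x i‖ ^ 2 : ℝ) : ℂ) := by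
  simp only [dotProduct, Pi.star_apply, Complex.ofReal_sum]
  refine Finset.sum_congr rfl fun i _ => ?_
  rw [mul_comm, ← starRingEnd_apply, Complex.mul_conj, Complex.normSq_eq_norm_sq]

/-- A Hermitian matrix whose quadratic form lies between `0` and `Λ` times the squared norm has
operator norm at most `Λ`. -/
lemma Matrix.IsHermitian.sum_norm_sq_mulVec_le {C : Matrix ι ι ℂ} (hC : C.IsHermitian)
    (h0 : ∀ x : ι → ℂ, 0 ≤ (star x ⬝ᵥ (C *ᵥ x)).re) {Λ : ℝ} (hΛ : 0 < Λ)
    (h1 : ∀ x : ι → ℂ, (star x ⬝ᵥ (C *ᵥ x)).re ≤ Λ * ∑ i, ‖x i‖ ^ 2) (x : ι → ℂ) :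
    ∑ i, ‖(C *ᵥ x) i‖ ^ 2 ≤ Λ ^ 2 * ∑ i, ‖x i‖ ^ 2 := by
  set u := C *ᵥ x with hu
  set t : ℂ := ((Λ⁻¹ : ℝ) : ℂ) with ht
  -- the form is nonnegative at `x - Λ⁻¹ • C x`
  have e1 : star u ⬝ᵥ (C *ᵥ x) = ((∑ i, ‖u i‖ ^ 2 : ℝ) : ℂ) := by
    rw [← hu, star_dotProduct_self_eq]
  have e2 : star x ⬝ᵥ (C *ᵥ u) = ((∑ i, ‖u i‖ ^ 2 : ℝ) : ℂ) := by
    rw [Matrix.dotProduct_mulVec]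
    conv_lhs => rw [← hC]
    rw [← Matrix.star_mulVec, ← hu, star_dotProduct_self_eq]
  have hts : star t = t := by rw [ht]; exact Complex.conj_ofReal _
  have e3 : star (x - t • u) ⬝ᵥ (C *ᵥ (x - t • u))
      = star x ⬝ᵥ (C *ᵥ x) - 2 * t * ((∑ i, ‖u i‖ ^ 2 : ℝ) : ℂ)
        + t * t * (star u ⬝ᵥ (C *ᵥ u)) := by
    rw [Matrix.mulVec_sub, Matrix.mulVec_smul, star_sub, star_smul, hts]
    simp only [sub_dotProduct, dotProduct_sub, smul_dotProduct, dotProduct_smul, smul_eq_mul, e1,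
      e2]
    ring
  have h := h0 (x - t • u)
  rw [e3, ht] at h
  have hr : ∀ (r : ℝ) (z : ℂ), ((r : ℂ) * z).re = r * z.re := Complex.re_ofReal_mul
  have e4 : ((2 : ℂ) * ((Λ⁻¹ : ℝ) : ℂ) * ((∑ i, ‖u i‖ ^ 2 : ℝ) : ℂ)).re
      = 2 * Λ⁻¹ * ∑ i, ‖u i‖ ^ 2 := by
    norm_cast
  rw [Complex.add_re, Complex.sub_re, e4, ← Complex.ofReal_mul, hr] at h
  have a1 := h1 x
  have a2 := mul_le_mul_of_nonneg_left (h1 u) (by positivity : (0 : ℝ) ≤ Λ⁻¹ * Λ⁻¹)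
  have a3 : Λ⁻¹ * Λ⁻¹ * (Λ * ∑ i, ‖u i‖ ^ 2) = Λ⁻¹ * ∑ i, ‖u i‖ ^ 2 := by field_simp
  rw [a3] at a2
  have a4 : Λ⁻¹ * ∑ i, ‖u i‖ ^ 2 ≤ Λ * ∑ i, ‖x i‖ ^ 2 := by linarith
  calc ∑ i, ‖u i‖ ^ 2 = Λ * (Λ⁻¹ * ∑ i, ‖u i‖ ^ 2) := by field_simp
    _ ≤ Λ * (Λ * ∑ i, ‖x i‖ ^ 2) := by gcongr
    _ = Λ ^ 2 * ∑ i, ‖x i‖ ^ 2 := by ring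

/-- A matrix whose quadratic form is at least `c` times the squared norm has an inverse of operator
norm at most `c⁻¹`. -/
lemma sum_norm_sq_le_of_le_quadForm {C : Matrix ι ι ℂ} {c : ℝ} (hc : 0 < c) (z : ι → ℂ)
    (h : c * ∑ i, ‖z i‖ ^ 2 ≤ (star z ⬝ᵥ (C *ᵥ z)).re) :
    ∑ i, ‖z i‖ ^ 2 ≤ (c⁻¹) ^ 2 * ∑ i, ‖(C *ᵥ z) i‖ ^ 2 := by
  have h2 : (star z ⬝ᵥ (C *ᵥ z)).re
      ≤ c / 2 * ∑ i, ‖z i‖ ^ 2 + c⁻¹ / 2 * ∑ i, ‖(C *ᵥ z) i‖ ^ 2 := by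
    rw [dotProduct, Complex.re_sum, Finset.mul_sum, Finset.mul_sum, ← Finset.sum_add_distrib]
    refine Finset.sum_le_sum fun i _ => ?_
    refine (Complex.re_le_norm _).trans ?_
    rw [norm_mul, Pi.star_apply, norm_star]
    have := sq_nonneg (c * ‖z i‖ - ‖(C *ᵥ z) i‖)
    have e : c / 2 * ‖z i‖ ^ 2 + c⁻¹ / 2 * ‖(C *ᵥ z) i‖ ^ 2 - ‖z i‖ * ‖(C *ᵥ z) i‖
        = c⁻¹ / 2 * (c * ‖z i‖ - ‖(C *ᵥ z) i‖) ^ 2 := by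
      field_simp; ring
    have : 0 ≤ c⁻¹ / 2 * (c * ‖z i‖ - ‖(C *ᵥ z) i‖) ^ 2 := by positivity
    linarith
  have h3 : c / 2 * ∑ i, ‖z i‖ ^ 2 ≤ c⁻¹ / 2 * ∑ i, ‖(C *ᵥ z) i‖ ^ 2 := by linarith
  calc ∑ i, ‖z i‖ ^ 2 = 2 * c⁻¹ * (c / 2 * ∑ i, ‖z i‖ ^ 2) := by field_simp
    _ ≤ 2 * c⁻¹ * (c⁻¹ / 2 * ∑ i, ‖(C *ᵥ z) i‖ ^ 2) := by gcongr
    _ = (c⁻¹) ^ 2 * ∑ i, ‖(C *ᵥ z) i‖ ^ 2 := by ring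

end forms

/-! ### Optimality of the conditional expectation -/

/-- The conditional expectation minimizes the mean squared error among square-integrable estimators
measurable with respect to the conditioning σ-algebra. -/
lemma integral_norm_condExp_sub_sq_le {Ω E : Type*} {m m₀ : MeasurableSpace Ω} {μ : Measure Ω}
    [IsProbabilityMeasure μ] [NormedAddCommGroup E] [InnerProductSpace ℝ E] [CompleteSpace E]
    (hm : m ≤ m₀) {f g : Ω → E} (hf : MemLp f 2 μ) (hg : MemLp g 2 μ)
    (hgm : StronglyMeasurable[m] g) :
    ∫ ω, ‖μ[f|m] ω - f ω‖ ^ 2 ∂μ ≤ ∫ ω, ‖g ω - f ω‖ ^ 2 ∂μ := by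
  have hF : MemLp (μ[f|m]) 2 μ := hf.condExp (by norm_num)
  have hd : MemLp (fun ω => g ω - μ[f|m] ω) 2 μ := hg.sub hF
  have hdm : StronglyMeasurable[m] fun ω => g ω - μ[f|m] ω := hgm.sub stronglyMeasurable_condExp
  have hin : ∀ {u v : Ω → E}, MemLp u 2 μ → MemLp v 2 μ →
      Integrable (fun ω => inner ℝ (u ω) (v ω)) μ := fun {u v} hu hv => by
    refine Integrable.mono' (hu.norm.integrable_mul hv.norm)
      (hu.aestronglyMeasurable.inner hv.aestronglyMeasurable) (.of_forall fun ω => ?_)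
    exact norm_inner_le_norm _ _
  have hpull := condExp_bilin_of_stronglyMeasurable_left (m := m) (μ := μ) (innerSL ℝ (E := E))
    hdm (hin hd hf) (hf.integrable (by norm_num))
  have hcross : ∫ ω, inner ℝ (g ω - μ[f|m] ω) (f ω) ∂μ
      = ∫ ω, inner ℝ (g ω - μ[f|m] ω) (μ[f|m] ω) ∂μ := by
    rw [← integral_condExp hm]
    exact integral_congr_ae hpull
  have e : ∀ ω, ‖g ω - f ω‖ ^ 2 = ‖g ω - μ[f|m] ω‖ ^ 2 + ‖μ[f|m] ω - f ω‖ ^ 2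
      + 2 * (inner ℝ (g ω - μ[f|m] ω) (μ[f|m] ω) - inner ℝ (g ω - μ[f|m] ω) (f ω)) := by
    intro ω
    rw [← inner_sub_right, show g ω - f ω = (g ω - μ[f|m] ω) + (μ[f|m] ω - f ω) by abel,
      norm_add_sq_real]
    ring
  have i1 : Integrable (fun ω => ‖g ω - μ[f|m] ω‖ ^ 2) μ := hd.integrable_norm_pow (by norm_num)
  have i2 : Integrable (fun ω => ‖μ[f|m] ω - f ω‖ ^ 2) μ :=
    (hF.sub hf).integrable_norm_pow (by norm_num)
  have i3 : Integrable (fun ω => 2 * (inner ℝ (g ω - μ[f|m] ω) (μ[f|m] ω)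
      - inner ℝ (g ω - μ[f|m] ω) (f ω))) μ := ((hin hd hF).sub (hin hd hf)).const_mul 2
  simp_rw [e]
  have e2 : ∫ ω, (‖g ω - μ[f|m] ω‖ ^ 2 + ‖μ[f|m] ω - f ω‖ ^ 2
      + 2 * (inner ℝ (g ω - μ[f|m] ω) (μ[f|m] ω) - inner ℝ (g ω - μ[f|m] ω) (f ω))) ∂μ
      = ∫ ω, ‖g ω - μ[f|m] ω‖ ^ 2 ∂μ + ∫ ω, ‖μ[f|m] ω - f ω‖ ^ 2 ∂μ := by
    rw [integral_add (f := fun ω => ‖g ω - μ[f|m] ω‖ ^ 2 + ‖μ[f|m] ω - f ω‖ ^ 2) (i1.add i2) i3,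
      integral_add i1 i2, integral_const_mul, integral_sub (hin hd hF) (hin hd hf), hcross]
    ring
  rw [e2]
  have : 0 ≤ ∫ ω, ‖g ω - μ[f|m] ω‖ ^ 2 ∂μ := integral_nonneg fun ω => by positivity
  linarith

/-! ### Power of cyclostationary processes -/

section cyclo

variable {Ω : Type*} [MeasurableSpace Ω] {μ : Measure Ω} {X : ℤ → Ω → ℂ} {K : ℕ}

lemma integral_norm_sq_eq_autocov (n : ℤ) :
    ((∫ ω, ‖X n ω‖ ^ 2 ∂μ : ℝ) : ℂ) = autocov X μ n n := by
  rw [autocov, ← integral_complex_ofReal]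
  refine integral_congr_ae (.of_forall fun ω => ?_)
  simp only
  rw [← starRingEnd_apply, Complex.mul_conj, Complex.normSq_eq_norm_sq]

lemma IsCyclostationary.periodic_power (h : IsCyclostationary X K μ) :
    Function.Periodic (fun n : ℤ => ∫ ω, ‖X n ω‖ ^ 2 ∂μ) (K : ℤ) := fun n => by
  have := h n n
  rw [← integral_norm_sq_eq_autocov,
    ← integral_norm_sq_eq_autocov] at this
  exact Complex.ofReal_injective this

lemma HasUnitAveragePower.sum_eq (hp : HasUnitAveragePower X K μ) (hK : 0 < K) :
    ∑ n ∈ Finset.range K, ∫ ω, ‖X n ω‖ ^ 2 ∂μ = K := by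
  have hK' : (0 : ℝ) < K := by exact_mod_cast hK
  have := hp
  rw [HasUnitAveragePower] at this
  field_simp at this
  exact this

lemma IsCyclostationary.power_le (h : IsCyclostationary X K μ) (hp : HasUnitAveragePower X K μ)
    (hK : 0 < K) (n : ℤ) : ∫ ω, ‖X n ω‖ ^ 2 ∂μ ≤ K := by
  have hK' : (0 : ℤ) < K := by exact_mod_cast hK
  have e := h.periodic_power.int_mul (-(n / K)) n
  rw [← e]
  have e2 : n + -(n / K) * K = ((n % K).toNat : ℤ) := by
    rw [Int.toNat_of_nonneg (Int.emod_nonneg _ hK'.ne'), Int.emod_def]; ring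
  simp only [Int.cast_id] at e ⊢
  rw [e2]
  have hlt : (n % K).toNat < K := by
    have := Int.emod_lt_of_pos n hK'
    omega
  calc _ ≤ ∑ n ∈ Finset.range K, ∫ ω, ‖X n ω‖ ^ 2 ∂μ :=
        Finset.single_le_sum (f := fun n : ℕ => ∫ ω, ‖X n ω‖ ^ 2 ∂μ)
          (fun i _ => integral_nonneg fun ω => by positivity) (Finset.mem_range.2 hlt)
    _ = K := hp.sum_eq hK

/-- Over `N ≥ K` samples the total power is at least `N / 2`: it is `K` on each full period. -/
lemma IsCyclostationary.le_sum_power (h : IsCyclostationary X K μ)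
    (hp : HasUnitAveragePower X K μ) (hK : 0 < K) {N : ℕ} (hN : K ≤ N) :
    (N : ℝ) / 2 ≤ ∑ i : Fin N, ∫ ω, ‖X (((i : ℕ) : ℤ) + 1) ω‖ ^ 2 ∂μ := by
  set σ : ℤ → ℝ := fun n => ∫ ω, ‖X n ω‖ ^ 2 ∂μ with hσ
  have hper : Function.Periodic σ (K : ℤ) := h.periodic_power
  have h0 : ∀ n, 0 ≤ σ n := fun n => integral_nonneg fun ω => by positivity
  have hone : ∑ n ∈ Finset.range K, σ ((n : ℤ) + 1) = K := by
    have e1 := Finset.sum_range_succ (fun n : ℕ => σ n) K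
    have e2 := Finset.sum_range_succ' (fun n : ℕ => σ n) K
    have e3 : σ (K : ℤ) = σ 0 := by simpa using hper 0
    have e4 : ∑ n ∈ Finset.range K, σ n = K := hp.sum_eq hK
    push_cast at e2
    rw [e1, e3, e4] at e2
    linarith
  have hq : ∀ q : ℕ, ∑ n ∈ Finset.range (q * K), σ ((n : ℤ) + 1) = q * K := by
    intro q
    induction q with
    | zero => simp
    | succ q ih =>
      rw [Nat.succ_mul, Finset.sum_range_add, ih]
      have : ∀ n : ℕ, σ (((q * K + n : ℕ) : ℤ) + 1) = σ ((n : ℤ) + 1) := fun n => by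
        have := hper.int_mul q ((n : ℤ) + 1)
        rw [← this]
        congr 1
        push_cast; ring
      simp only [this, hone]
      push_cast; ring
  rw [Fin.sum_univ_eq_sum_range (fun i : ℕ => σ ((i : ℤ) + 1)) N]
  have hle : N / K * K ≤ N := Nat.div_mul_le_self N K
  have hge : N ≤ 2 * (N / K * K) := by
    have h1 : 1 ≤ N / K := (Nat.one_le_div_iff hK).2 hN
    have h2 := Nat.div_add_mod N K
    have h3 := Nat.mod_lt N hK
    nlinarith
  calc (N : ℝ) / 2 ≤ ((N / K : ℕ) : ℝ) * K := by
        have : (N : ℝ) ≤ 2 * (((N / K : ℕ) : ℝ) * K) := by exact_mod_cast hge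
        linarith
    _ = ∑ n ∈ Finset.range (N / K * K), σ ((n : ℤ) + 1) := (hq _).symm
    _ ≤ _ := Finset.sum_le_sum_of_subset_of_nonneg (Finset.range_mono hle) fun i _ _ => h0 _

end cyclo

/-! ### Selecting one of finitely many estimators -/

section selection

variable {Ω E : Type*}

lemma measurable_selection {m : MeasurableSpace Ω} [MeasurableSpace E] {G : ℕ → Ω → E}
    (hG : ∀ k, Measurable (G k)) {k : Ω → ℕ} (hk : Measurable k) :
    Measurable fun ω => G (k ω) ω := by
  have h : Measurable fun p : ℕ × Ω => G p.1 p.2 := measurable_from_prod_countable_right hG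
  exact h.comp (hk.prodMk measurable_id)

lemma memLp_selection [MeasurableSpace Ω] {μ : Measure Ω} [NormedAddCommGroup E] {p : ℝ≥0∞}
    {G : ℕ → Ω → E} {s : Finset ℕ} (hG : ∀ m ∈ s, MemLp (G m) p μ) {k : Ω → ℕ}
    (hk : ∀ᵐ ω ∂μ, k ω ∈ s) (hm : AEStronglyMeasurable (fun ω => G (k ω) ω) μ) :
    MemLp (fun ω => G (k ω) ω) p μ := by
  have h : MemLp (fun ω => ∑ m ∈ s, ‖G m ω‖) p μ := memLp_finsetSum s fun m hm => (hG m hm).norm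
  refine h.of_le hm ?_
  filter_upwards [hk] with ω hω
  rw [Real.norm_of_nonneg (Finset.sum_nonneg fun _ _ => norm_nonneg _)]
  exact Finset.single_le_sum (f := fun m => ‖G m ω‖) (fun _ _ => norm_nonneg _) hω

end selection

namespace Mixture

variable {Ω : Type*} [MeasurableSpace Ω] {μ : Measure Ω} {M : Mixture Ω}

/-! ### The joint Gaussian family of the three sources -/

/-- The three source processes `s`, `b`, `w` as one family indexed by `Fin 3 × ℤ`. -/
def sources (M : Mixture Ω) : Fin 3 × ℤ → Ω → ℂ := fun p => ![M.s, M.b, M.w] p.1 p.2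

namespace IsGaussianModel

lemma isCircular_sources (hM : M.IsGaussianModel μ) (i : Fin 3) :
    IsCircularGaussianProcess (fun n => M.sources (i, n)) μ := by
  fin_cases i
  exacts [hM.s_gaussian, hM.b_gaussian, hM.w_gaussian]

lemma measurable_sources (hM : M.IsGaussianModel μ) (p : Fin 3 × ℤ) : Measurable (M.sources p) :=
  (hM.isCircular_sources p.1).measurable p.2

lemma iIndepFun_sources (hM : M.IsGaussianModel μ) :
    iIndepFun (fun (i : Fin 3) ω (n : ℤ) => M.sources (i, n) ω) μ := by
  have h := hM.indep.precomp (Fin.castSucc_injective 3)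
  rw [iIndepFun_iff_iIndep]
  convert h using 1
  ext i : 1
  fin_cases i <;> rfl

lemma indepFun_sources_kb (hM : M.IsGaussianModel μ) :
    IndepFun (fun ω p => M.sources p ω) M.kb μ := by
  have hs : Measurable fun ω n => M.s n ω := measurable_pi_iff.2 hM.s_gaussian.measurable
  have hb : Measurable fun ω n => M.b n ω := measurable_pi_iff.2 hM.b_gaussian.measurable
  have hw : Measurable fun ω n => M.w n ω := measurable_pi_iff.2 hM.w_gaussian.measurable
  set m : Fin 4 → MeasurableSpace Ω :=
    ![MeasurableSpace.comap (fun ω n => M.s n ω) (inferInstance : MeasurableSpace (ℤ → ℂ)),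
      MeasurableSpace.comap (fun ω n => M.b n ω) (inferInstance : MeasurableSpace (ℤ → ℂ)),
      MeasurableSpace.comap (fun ω n => M.w n ω) (inferInstance : MeasurableSpace (ℤ → ℂ)),
      MeasurableSpace.comap M.kb (inferInstance : MeasurableSpace ℕ)] with hm
  have h := indep_iSup_of_disjoint (m := m) (S := {0, 1, 2}) (T := {3}) (fun i => by
    fin_cases i
    exacts [hs.comap_le, hb.comap_le, hw.comap_le, hM.kb_measurable.comap_le]) hM.indep
    (by simp)
  rw [IndepFun_iff_Indep]
  refine indep_of_indep_of_le_left (indep_of_indep_of_le_right h ?_) ?_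
  · exact le_iSup₂_of_le (f := fun i _ => m i) 3 (by simp) le_rfl
  · rw [← measurable_iff_comap_le]
    refine @measurable_pi_lambda _ _ _ (_) _ _ fun p => ?_
    obtain ⟨i, n⟩ := p
    have key : ∀ (j : Fin 4) (_ : j ∈ ({0, 1, 2} : Set (Fin 4))) (X : ℤ → Ω → ℂ),
        m j = MeasurableSpace.comap (fun ω n => X n ω) inferInstance →
        Measurable[⨆ i ∈ ({0, 1, 2} : Set (Fin 4)), m i] (X n) := by
      intro j hj X hX
      have h1 : MeasurableSpace.comap (fun ω n => X n ω) inferInstance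
          ≤ ⨆ i ∈ ({0, 1, 2} : Set (Fin 4)), m i :=
        le_iSup₂_of_le (f := fun i _ => m i) j hj hX.ge
      exact ((measurable_pi_apply n).comp
        (comap_measurable (fun ω n => X n ω))).mono h1 le_rfl
    fin_cases i
    · exact key 0 (by simp) M.s rfl
    · exact key 1 (by simp) M.b rfl
    · exact key 2 (by simp) M.w rfl

lemma memLp_sources (hM : M.IsGaussianModel μ) (p : Fin 3 × ℤ) : MemLp (M.sources p) 2 μ :=
  ((hM.isCircular_sources p.1).gaussian.hasGaussianLaw_eval p.2).memLp_two

lemma integral_sources (hM : M.IsGaussianModel μ) (p : Fin 3 × ℤ) :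
    ∫ ω, M.sources p ω ∂μ = 0 := (hM.isCircular_sources p.1).mean_zero p.2

lemma indepFun_sources (hM : M.IsGaussianModel μ) {p q : Fin 3 × ℤ} (h : p.1 ≠ q.1) :
    IndepFun (M.sources p) (M.sources q) μ :=
  (hM.iIndepFun_sources.indepFun h).comp (measurable_pi_apply p.2) (measurable_pi_apply q.2)

lemma integral_sources_mul_star (hM : M.IsGaussianModel μ) {p q : Fin 3 × ℤ} (h : p.1 ≠ q.1) :
    ∫ ω, M.sources p ω * star (M.sources q ω) ∂μ = 0 := by
  have hi : IndepFun (M.sources p) (fun ω => star (M.sources q ω)) μ :=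
    (hM.indepFun_sources h).comp measurable_id continuous_star.measurable
  rw [hi.integral_fun_mul_eq_mul_integral (hM.measurable_sources p).aestronglyMeasurable
    (hM.memLp_sources q).star.aestronglyMeasurable, hM.integral_sources, zero_mul]

lemma isProperGaussian_sources (hM : M.IsGaussianModel μ) : IsProperGaussian M.sources μ := by
  classical
  refine ⟨hM.measurable_sources, ⟨fun I => ?_⟩, hM.integral_sources, fun p q => ?_⟩
  · set J : Finset ℤ := I.image Prod.snd with hJ
    have hmem : ∀ p : I, p.1.2 ∈ J := fun p => Finset.mem_image_of_mem _ p.2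
    have h1 : iIndepFun (fun (i : Fin 3) ω (n : J) => M.sources (i, n) ω) μ :=
      hM.iIndepFun_sources.comp (fun _ x (n : J) => x n)
        (fun _ => measurable_pi_lambda _ fun n => measurable_pi_apply _)
    have h2 := h1.hasGaussianLaw fun i => (hM.isCircular_sources i).gaussian.hasGaussianLaw J
    exact h2.map (ContinuousLinearMap.pi fun p : I =>
      (ContinuousLinearMap.proj (R := ℝ) (φ := fun _ : J => ℂ) ⟨p.1.2, hmem p⟩) ∘L
        (ContinuousLinearMap.proj (R := ℝ) (φ := fun _ : Fin 3 => J → ℂ) p.1.1))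
  · by_cases h : p.1 = q.1
    · obtain ⟨i, n⟩ := p
      obtain ⟨j, m⟩ := q
      obtain rfl : i = j := h
      exact (hM.isCircular_sources i).pseudoCov_zero n m
    · rw [(hM.indepFun_sources h).integral_fun_mul_eq_mul_integral
        (hM.measurable_sources p).aestronglyMeasurable
        (hM.measurable_sources q).aestronglyMeasurable, hM.integral_sources, zero_mul]

/-! ### Conditioning on the shift -/

lemma ae_kb_mem (hM : M.IsGaussianModel μ) : ∀ᵐ ω ∂μ, M.kb ω ∈ Finset.Icc 1 M.Kb := by
  have := hM.s_gaussian.gaussian.isProbabilityMeasure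
  have h : μ (M.kb ⁻¹' (Finset.Icc 1 M.Kb : Finset ℕ)) = 1 := by
    rw [← Set.biUnion_preimage_singleton]
    simp only [Finset.mem_coe]
    rw [measure_biUnion_finset]
    · rw [Finset.sum_congr rfl hM.kb_uniform]
      simp only [Finset.sum_const, Nat.card_Icc, add_tsub_cancel_right, nsmul_eq_mul]
      exact ENNReal.mul_inv_cancel (by exact_mod_cast hM.Kb_pos.ne') (by simp)
    · intro i _ j _ hij
      exact Set.disjoint_left.2 fun ω h1 h2 => hij (h1.symm.trans h2)
    · intro m _
      exact hM.kb_measurable (measurableSet_singleton m)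
  have h2 := (prob_compl_eq_zero_iff (hM.kb_measurable (Finset.measurableSet _))).2 h
  exact measure_mono_null (fun ω hω => hω) h2

lemma integral_eq_sum_setIntegral (hM : M.IsGaussianModel μ) {E : Type*} [NormedAddCommGroup E]
    [NormedSpace ℝ E] {f : Ω → E} (hf : Integrable f μ) :
    ∫ ω, f ω ∂μ = ∑ m ∈ Finset.Icc 1 M.Kb, ∫ ω in M.kb ⁻¹' {m}, f ω ∂μ := by
  rw [← integral_biUnion_finset]
  · have hu : (⋃ m ∈ Finset.Icc 1 M.Kb, M.kb ⁻¹' {m}) =ᵐ[μ] Set.univ := by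
      filter_upwards [hM.ae_kb_mem] with ω hω
      have : ω ∈ (⋃ m ∈ Finset.Icc 1 M.Kb, M.kb ⁻¹' {m}) := by
        simp only [Set.mem_iUnion]; exact ⟨M.kb ω, hω, rfl⟩
      exact propext ⟨fun _ => trivial, fun _ => this⟩
    rw [setIntegral_congr_set hu, setIntegral_univ]
  · intro m _; exact hM.kb_measurable (measurableSet_singleton m)
  · intro i _ j _ hij
    exact Set.disjoint_left.2 fun ω h1 h2 => hij (h1.symm.trans h2)
  · intro m _; exact hf.integrableOn

/-- The shift is independent of the sources, so conditioning on it does not affect expectations of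
functionals of the sources. No integrability is needed. -/
lemma setIntegral_kb_eq (hM : M.IsGaussianModel μ) {E : Type*} [NormedAddCommGroup E]
    [NormedSpace ℝ E] [MeasurableSpace E] [BorelSpace E] [SecondCountableTopology E]
    {m : ℕ} (hm : m ∈ Finset.Icc 1 M.Kb) {F : Ω → E} (f : (Fin 3 × ℤ → ℂ) → E) (hf : Measurable f)
    (hF : ∀ ω ∈ M.kb ⁻¹' {m}, F ω = f fun p => M.sources p ω) :
    ∫ ω in M.kb ⁻¹' {m}, F ω ∂μ = (M.Kb : ℝ)⁻¹ • ∫ ω, f (fun p => M.sources p ω) ∂μ := by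
  have hU : Measurable fun ω p => M.sources p ω := measurable_pi_iff.2 hM.measurable_sources
  have hS : MeasurableSet (M.kb ⁻¹' {m}) := hM.kb_measurable (measurableSet_singleton m)
  have hmap : (μ.restrict (M.kb ⁻¹' {m})).map (fun ω p => M.sources p ω)
      = (M.Kb : ℝ≥0∞)⁻¹ • μ.map (fun ω p => M.sources p ω) := by
    ext A hA
    rw [Measure.map_apply hU hA, Measure.restrict_apply (hU hA), Measure.smul_apply,
      Measure.map_apply hU hA, hM.indepFun_sources_kb.measure_inter_preimage_eq_mul _ _ hA
      (measurableSet_singleton m), hM.kb_uniform m hm, smul_eq_mul, mul_comm]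
  rw [setIntegral_congr_fun hS hF,
    ← integral_map (μ := μ.restrict (M.kb ⁻¹' {m})) hU.aemeasurable hf.aestronglyMeasurable,
    hmap, integral_smul_measure, integral_map hU.aemeasurable hf.aestronglyMeasurable]
  simp

lemma integral_cond_kb_eq (hM : M.IsGaussianModel μ) {E : Type*} [NormedAddCommGroup E]
    [NormedSpace ℝ E] [MeasurableSpace E] [BorelSpace E] [SecondCountableTopology E]
    {m : ℕ} (hm : m ∈ Finset.Icc 1 M.Kb) {F : Ω → E} (f : (Fin 3 × ℤ → ℂ) → E) (hf : Measurable f)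
    (hF : ∀ ω ∈ M.kb ⁻¹' {m}, F ω = f fun p => M.sources p ω) :
    ∫ ω, F ω ∂(μ[|M.kb ⁻¹' {m}]) = ∫ ω, f (fun p => M.sources p ω) ∂μ := by
  have hK : (M.Kb : ℝ) ≠ 0 := by exact_mod_cast hM.Kb_pos.ne'
  rw [ProbabilityTheory.cond, integral_smul_measure, hM.setIntegral_kb_eq hm f hf hF,
    hM.kb_uniform m hm, smul_smul]
  simp [hK]

end IsGaussianModel

/-! ### The observation for a fixed shift -/

/-- The signal of interest at times `1, …, N`, as a family of complex random variables. -/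
def signal (M : Mixture Ω) (N : ℕ) : Fin N → Ω → ℂ := fun i => M.s (((i : ℕ) : ℤ) + 1)

/-- The equivalent noise at times `1, …, N` when the shift of the interference is the constant `m`.
-/
noncomputable def shiftedNoise (M : Mixture Ω) (m N : ℕ) : Fin N → Ω → ℂ := fun i ω =>
  ((√M.ρSIR)⁻¹ : ℝ) * M.b (((i : ℕ) : ℤ) + 1 - m) ω + ((√M.ρSNR)⁻¹ : ℝ) * M.w (((i : ℕ) : ℤ) + 1) ω

/-- The observation at times `1, …, N` when the shift of the interference is the constant `m`. -/
noncomputable def shiftedObs (M : Mixture Ω) (m N : ℕ) : Fin N → Ω → ℂ := fun i ω =>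
  M.signal N i ω + M.shiftedNoise m N i ω

omit [MeasurableSpace Ω] in
lemma vVec_apply_of_kb_eq {m : ℕ} {ω : Ω} (h : M.kb ω = m) (N : ℕ) (i : Fin N) :
    M.vVec N ω i = M.shiftedNoise m N i ω := by
  simp [vVec, v, shiftedNoise, h]

omit [MeasurableSpace Ω] in
lemma yVec_apply_of_kb_eq {m : ℕ} {ω : Ω} (h : M.kb ω = m) (N : ℕ) (i : Fin N) :
    M.yVec N ω i = M.shiftedObs m N i ω := by
  simp [yVec, shiftedObs, vVec_apply_of_kb_eq h, sVec, signal]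

omit [MeasurableSpace Ω] in
lemma yVec_ofLp_of_kb_eq {m : ℕ} {ω : Ω} (h : M.kb ω = m) (N : ℕ) :
    (M.yVec N ω).ofLp = fun i => M.shiftedObs m N i ω :=
  funext fun i => yVec_apply_of_kb_eq h N i

lemma Css_eq (M : Mixture Ω) (μ : Measure Ω) (N : ℕ) :
    M.Css μ N = covMat (M.signal N) (M.signal N) μ := rfl

/-- The span of the sources whose label (`0` for `s`, `1` for `b`, `2` for `w`) belongs to `A`. -/
def sourceSpan (M : Mixture Ω) (A : Set (Fin 3)) : Submodule ℂ (Ω → ℂ) :=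
  Submodule.span ℂ (Set.range fun p : {p : Fin 3 × ℤ // p.1 ∈ A} => M.sources p)

/-- The shifted noise as a function of the sources. -/
noncomputable def noiseOfSources (M : Mixture Ω) (m N : ℕ) (u : Fin 3 × ℤ → ℂ) (i : Fin N) : ℂ :=
  ((√M.ρSIR)⁻¹ : ℝ) * u (1, ((i : ℕ) : ℤ) + 1 - m) + ((√M.ρSNR)⁻¹ : ℝ) * u (2, ((i : ℕ) : ℤ) + 1)

omit [MeasurableSpace Ω] in
lemma measurable_noiseOfSources (M : Mixture Ω) (m N : ℕ) : Measurable (M.noiseOfSources m N) := by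
  unfold noiseOfSources
  fun_prop

namespace IsGaussianModel

lemma Cvv_eq (hM : M.IsGaussianModel μ) {m : ℕ} (hm : m ∈ Finset.Icc 1 M.Kb) (N : ℕ) :
    M.Cvv μ N m = covMat (M.shiftedNoise m N) (M.shiftedNoise m N) μ := by
  ext i l
  simp only [Cvv, covMat, Matrix.of_apply]
  rw [hM.integral_cond_kb_eq hm
    (fun u => M.noiseOfSources m N u i * star (M.noiseOfSources m N u l))]
  · rfl
  · have := M.measurable_noiseOfSources m N
    fun_prop
  · intro ω hω
    rw [vVec_apply_of_kb_eq hω, vVec_apply_of_kb_eq hω]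
    rfl

omit [MeasurableSpace Ω] in
lemma source_mem_span (M : Mixture Ω) (p : Fin 3 × ℤ) :
    M.sources p ∈ Submodule.span ℂ (Set.range M.sources) := Submodule.subset_span ⟨p, rfl⟩

omit [MeasurableSpace Ω] in
lemma signal_mem_span (M : Mixture Ω) (N : ℕ) (i : Fin N) :
    M.signal N i ∈ Submodule.span ℂ (Set.range M.sources) :=
  source_mem_span M (0, ((i : ℕ) : ℤ) + 1)

omit [MeasurableSpace Ω] in
lemma shiftedNoise_mem_span (M : Mixture Ω) (m N : ℕ) (i : Fin N) :
    M.shiftedNoise m N i ∈ Submodule.span ℂ (Set.range M.sources) :=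
  add_mem (Submodule.smul_mem _ _ (source_mem_span M (1, ((i : ℕ) : ℤ) + 1 - m)))
    (Submodule.smul_mem _ _ (source_mem_span M (2, ((i : ℕ) : ℤ) + 1)))

omit [MeasurableSpace Ω] in
lemma shiftedObs_mem_span (M : Mixture Ω) (m N : ℕ) (i : Fin N) :
    M.shiftedObs m N i ∈ Submodule.span ℂ (Set.range M.sources) :=
  add_mem (signal_mem_span M N i) (shiftedNoise_mem_span M m N i)

lemma memLp_of_mem_span (hM : M.IsGaussianModel μ) {Y : Ω → ℂ}
    (hY : Y ∈ Submodule.span ℂ (Set.range M.sources)) : MemLp Y 2 μ :=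
  memLp_two_of_mem_span hM.memLp_sources hY

lemma isProperGaussian_shiftedObs (hM : M.IsGaussianModel μ) (m N : ℕ) :
    IsProperGaussian (M.shiftedObs m N) μ :=
  hM.isProperGaussian_sources.of_mem_span (shiftedObs_mem_span M m N)

omit [MeasurableSpace Ω] in
lemma s_mem_sourceSpan (M : Mixture Ω) {A : Set (Fin 3)} (h : 0 ∈ A) (n : ℤ) :
    M.s n ∈ M.sourceSpan A := Submodule.subset_span ⟨⟨(0, n), h⟩, rfl⟩

omit [MeasurableSpace Ω] in
lemma b_mem_sourceSpan (M : Mixture Ω) {A : Set (Fin 3)} (h : 1 ∈ A) (n : ℤ) :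
    M.b n ∈ M.sourceSpan A := Submodule.subset_span ⟨⟨(1, n), h⟩, rfl⟩

omit [MeasurableSpace Ω] in
lemma w_mem_sourceSpan (M : Mixture Ω) {A : Set (Fin 3)} (h : 2 ∈ A) (n : ℤ) :
    M.w n ∈ M.sourceSpan A := Submodule.subset_span ⟨⟨(2, n), h⟩, rfl⟩

omit [MeasurableSpace Ω] in
lemma sourceSpan_mono (M : Mixture Ω) {A B : Set (Fin 3)} (h : A ⊆ B) :
    M.sourceSpan A ≤ M.sourceSpan B :=
  Submodule.span_mono fun _ ⟨q, hq⟩ => ⟨⟨q.1, h q.2⟩, hq⟩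

lemma memLp_of_mem_sourceSpan (hM : M.IsGaussianModel μ) {A : Set (Fin 3)} {Y : Ω → ℂ}
    (hY : Y ∈ M.sourceSpan A) : MemLp Y 2 μ :=
  memLp_two_of_mem_span (fun _ => hM.memLp_sources _) hY

/-- Combinations of sources with labels in disjoint sets are uncorrelated. -/
lemma integral_mul_star_eq_zero (hM : M.IsGaussianModel μ) {A B : Set (Fin 3)} (hAB : Disjoint A B)
    {x z : Ω → ℂ} (hx : x ∈ M.sourceSpan A) (hz : z ∈ M.sourceSpan B) :
    ∫ ω, x ω * star (z ω) ∂μ = 0 :=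
  integral_mul_star_eq_zero_of_mem_span (fun _ => hM.memLp_sources _) (fun _ => hM.memLp_sources _)
    (fun p q => hM.integral_sources_mul_star fun h =>
      Set.disjoint_left.1 hAB p.2 (h ▸ q.2)) hx hz

lemma integral_signal_mul_star_shiftedNoise (hM : M.IsGaussianModel μ) (m N : ℕ) (i j : Fin N) :
    ∫ ω, M.signal N i ω * star (M.shiftedNoise m N j ω) ∂μ = 0 := by
  refine hM.integral_mul_star_eq_zero (A := {0}) (B := {1, 2}) (by simp)
    (s_mem_sourceSpan M (Set.mem_singleton _) _) ?_
  unfold shiftedNoise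
  exact add_mem (Submodule.smul_mem _ _ (b_mem_sourceSpan M (by simp) _))
    (Submodule.smul_mem _ _ (w_mem_sourceSpan M (by simp) _))

lemma covMat_signal_shiftedObs (hM : M.IsGaussianModel μ) (m N : ℕ) :
    covMat (M.signal N) (M.shiftedObs m N) μ = M.Css μ N := by
  ext i j
  simp only [covMat, Css_eq, Matrix.of_apply, shiftedObs, star_add, mul_add]
  have h1 := hM.memLp_of_mem_span (signal_mem_span M N i)
  have h2 := hM.memLp_of_mem_span (signal_mem_span M N j)
  have h3 := hM.memLp_of_mem_span (shiftedNoise_mem_span M m N j)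
  rw [integral_add (h1.integrable_mul_star h2) (h1.integrable_mul_star h3),
    hM.integral_signal_mul_star_shiftedNoise, add_zero]

lemma covMat_shiftedObs (hM : M.IsGaussianModel μ) {m : ℕ} (hm : m ∈ Finset.Icc 1 M.Kb) (N : ℕ) :
    covMat (M.shiftedObs m N) (M.shiftedObs m N) μ = M.Cyy μ N m := by
  have h := hM.covMat_signal_shiftedObs m N
  have h' : covMat (M.shiftedNoise m N) (M.signal N) μ = 0 := by
    rw [← covMat_conjTranspose, Matrix.conjTranspose_eq_zero]
    ext i j
    exact hM.integral_signal_mul_star_shiftedNoise m N i j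
  rw [Cyy, hM.Cvv_eq hm]
  ext i j
  have hij := congrFun (congrFun h i) j
  have hij' := congrFun (congrFun h' i) j
  simp only [covMat, Matrix.of_apply, Matrix.zero_apply, Matrix.add_apply] at hij hij' ⊢
  rw [← hij]
  have h1 := hM.memLp_of_mem_span (signal_mem_span M N i)
  have h2 := hM.memLp_of_mem_span (signal_mem_span M N j)
  have h3 := hM.memLp_of_mem_span (shiftedNoise_mem_span M m N i)
  have h4 := hM.memLp_of_mem_span (shiftedNoise_mem_span M m N j)
  have h5 := hM.memLp_of_mem_span (shiftedObs_mem_span M m N j)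
  have e : ∀ ω, M.shiftedObs m N i ω * star (M.shiftedObs m N j ω)
      = M.signal N i ω * star (M.shiftedObs m N j ω)
        + (M.shiftedNoise m N i ω * star (M.signal N j ω)
          + M.shiftedNoise m N i ω * star (M.shiftedNoise m N j ω)) := by
    intro ω
    have hj : M.shiftedObs m N j ω = M.signal N j ω + M.shiftedNoise m N j ω := rfl
    have hi : M.shiftedObs m N i ω = M.signal N i ω + M.shiftedNoise m N i ω := rfl
    rw [← mul_add, ← star_add, ← hj, ← add_mul, ← hi]
  simp_rw [e]
  rw [integral_add (g := fun ω => M.shiftedNoise m N i ω * star (M.signal N j ω)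
      + M.shiftedNoise m N i ω * star (M.shiftedNoise m N j ω)) (h1.integrable_mul_star h5)
    ((h3.integrable_mul_star h2).add (h3.integrable_mul_star h4)),
    integral_add (h3.integrable_mul_star h2) (h3.integrable_mul_star h4), hij', zero_add]

lemma covMat_white (hM : M.IsGaussianModel μ) (N : ℕ) :
    covMat (fun i : Fin N => M.w (((i : ℕ) : ℤ) + 1)) (fun i : Fin N => M.w (((i : ℕ) : ℤ) + 1)) μ
      = 1 := by
  ext i j
  have h := hM.w_white (((i : ℕ) : ℤ) + 1) (((j : ℕ) : ℤ) + 1)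
  simp only [covMat, Matrix.of_apply, autocov] at h ⊢
  rw [h, Matrix.one_apply]
  congr 1
  simp [Fin.ext_iff]

/-- Replacing the signal by the observation in a linear combination costs at least the power of the
white noise, whatever the interference. -/
lemma integral_norm_sq_add_noise_le (hM : M.IsGaussianModel μ) (m N : ℕ) {p : Ω → ℂ}
    (hp : p ∈ Submodule.span ℂ (Set.range M.s)) (β : Fin N → ℂ) :
    ∫ ω, ‖p ω + ∑ j, β j * M.signal N j ω‖ ^ 2 ∂μ + M.ρSNR⁻¹ * ∑ j, ‖β j‖ ^ 2
      ≤ ∫ ω, ‖p ω + ∑ j, β j * M.shiftedObs m N j ω‖ ^ 2 ∂μ := by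
  set a : ℂ := (((√M.ρSIR)⁻¹ : ℝ) : ℂ) with ha
  set c : ℂ := (((√M.ρSNR)⁻¹ : ℝ) : ℂ) with hc
  set x : Ω → ℂ := p + ∑ j, β j • M.signal N j with hx
  set y : Ω → ℂ := ∑ j : Fin N, (β j * a) • M.b (((j : ℕ) : ℤ) + 1 - m) with hy
  set z : Ω → ℂ := ∑ j : Fin N, (β j * c) • M.w (((j : ℕ) : ℤ) + 1) with hz
  have hS : Submodule.span ℂ (Set.range M.s) ≤ M.sourceSpan {0} := by
    refine Submodule.span_le.2 ?_
    rintro _ ⟨n, rfl⟩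
    exact s_mem_sourceSpan M (Set.mem_singleton _) n
  have mx : x ∈ M.sourceSpan {0} := add_mem (hS hp) (Submodule.sum_mem _ fun j _ =>
    Submodule.smul_mem _ _ (s_mem_sourceSpan M (Set.mem_singleton _) _))
  have my : y ∈ M.sourceSpan {1} := Submodule.sum_mem _ fun j _ =>
    Submodule.smul_mem _ _ (b_mem_sourceSpan M (Set.mem_singleton _) _)
  have mz : z ∈ M.sourceSpan {2} := Submodule.sum_mem _ fun j _ =>
    Submodule.smul_mem _ _ (w_mem_sourceSpan M (Set.mem_singleton _) _)
  have mxy : x + y ∈ M.sourceSpan {0, 1} :=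
    add_mem (sourceSpan_mono M (by simp) mx) (sourceSpan_mono M (by simp) my)
  have e1 := integral_norm_add_sq_of_orthogonal (hM.memLp_of_mem_sourceSpan mx)
    (hM.memLp_of_mem_sourceSpan my)
    (hM.integral_mul_star_eq_zero (by simp) mx my)
  have e2 := integral_norm_add_sq_of_orthogonal (hM.memLp_of_mem_sourceSpan mxy)
    (hM.memLp_of_mem_sourceSpan mz)
    (hM.integral_mul_star_eq_zero (by simp) mxy mz)
  have e3 : ∫ ω, ‖z ω‖ ^ 2 ∂μ = M.ρSNR⁻¹ * ∑ j, ‖β j‖ ^ 2 := by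
    have h := star_dotProduct_covMat_mulVec (μ := μ)
      (X := fun i : Fin N => M.w (((i : ℕ) : ℤ) + 1)) (fun i => hM.memLp_sources (2, _))
      (fun j => star (β j * c))
    rw [hM.covMat_white, Matrix.one_mulVec] at h
    have h2 : (star fun j => star (β j * c)) ⬝ᵥ (fun j => star (β j * c))
        = ((M.ρSNR⁻¹ * ∑ j, ‖β j‖ ^ 2 : ℝ) : ℂ) := by
      simp only [dotProduct, Pi.star_apply, star_star]
      push_cast
      rw [Finset.mul_sum]
      refine Finset.sum_congr rfl fun j _ => ?_
      rw [← starRingEnd_apply, Complex.mul_conj, Complex.normSq_eq_norm_sq, norm_mul, mul_pow, hc,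
        Complex.norm_real, Real.norm_of_nonneg (by positivity), inv_pow,
        Real.sq_sqrt hM.ρSNR_pos.le]
      push_cast
      ring
    rw [h2] at h
    have h3 := Complex.ofReal_injective h
    rw [h3]
    refine integral_congr_ae (.of_forall fun ω => ?_)
    simp [hz]
  have f1 : ∀ ω, p ω + ∑ j, β j * M.signal N j ω = x ω := fun ω => by simp [hx]
  have f2 : ∀ ω, p ω + ∑ j, β j * M.shiftedObs m N j ω = (x + y) ω + z ω := fun ω => by
    simp only [hx, hy, hz, shiftedObs, shiftedNoise, Pi.add_apply, Finset.sum_apply, Pi.smul_apply,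
      smul_eq_mul, ← ha, ← hc, mul_add, Finset.sum_add_distrib]
    simp only [mul_assoc, add_assoc]
  simp_rw [f1, f2]
  rw [e2, e3]
  simp only [Pi.add_apply]
  rw [e1]
  have : 0 ≤ ∫ ω, ‖y ω‖ ^ 2 ∂μ := integral_nonneg fun ω => by positivity
  linarith

/-! ### Nondegeneracy and consistency of the posterior -/

lemma le_quadForm_Cyy (hM : M.IsGaussianModel μ) {m : ℕ} (hm : m ∈ Finset.Icc 1 M.Kb) {N : ℕ}
    (x : Fin N → ℂ) : ∃ q : ℝ, star x ⬝ᵥ (M.Cyy μ N m *ᵥ x) = (q : ℂ) ∧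
      M.ρSNR⁻¹ * ∑ i, ‖x i‖ ^ 2 ≤ q := by
  refine ⟨∫ ω, ‖∑ i, star (x i) * M.shiftedObs m N i ω‖ ^ 2 ∂μ, ?_, ?_⟩
  · rw [← hM.covMat_shiftedObs hm,
      star_dotProduct_covMat_mulVec (hM.isProperGaussian_shiftedObs m N).memLp]
  · have h := hM.integral_norm_sq_add_noise_le m N (p := 0) (zero_mem _) (fun i => star (x i))
    simp only [Pi.zero_apply, zero_add, norm_star] at h
    have h2 : 0 ≤ ∫ ω, ‖∑ j, star (x j) * M.signal N j ω‖ ^ 2 ∂μ :=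
      integral_nonneg fun ω => by positivity
    linarith

open scoped ComplexOrder in
lemma posDef_Cyy (hM : M.IsGaussianModel μ) {m : ℕ} (hm : m ∈ Finset.Icc 1 M.Kb) (N : ℕ) :
    (M.Cyy μ N m).PosDef := by
  refine Matrix.PosDef.of_dotProduct_mulVec_pos ?_ fun x hx => ?_
  · rw [← hM.covMat_shiftedObs hm]; exact covMat_self_isHermitian _
  · obtain ⟨q, hq, hle⟩ := hM.le_quadForm_Cyy hm x
    rw [hq]
    refine Complex.zero_lt_real.2 (lt_of_lt_of_le ?_ hle)
    have h0 := hM.ρSNR_pos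
    obtain ⟨i, hi⟩ := Function.ne_iff.1 hx
    refine mul_pos (by positivity) (Finset.sum_pos' (fun _ _ => by positivity) ⟨i, by simp, ?_⟩)
    have : 0 < ‖x i‖ := norm_pos_iff.2 hi
    positivity

/-- The statistic `ψ` at the true shift tends to zero. -/
lemma tendsto_ψ_kb (hM : M.IsGaussianModel μ) :
    ∀ᵐ ω ∂μ, Tendsto (fun N : ℕ => ‖M.ψ μ N (M.kb ω) ω‖) atTop (𝓝 0) := by
  have h : ∀ k ∈ Finset.Icc 1 M.Kb, ∀ᵐ ω ∂μ, M.kb ω = k →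
      Tendsto (fun N : ℕ => ‖M.ψ μ N k ω‖) atTop (𝓝 0) := by
    intro k hk
    have := IsProperGaussian.tendsto_quadForm (fun N => hM.isProperGaussian_shiftedObs k N)
      (fun N => by rw [hM.covMat_shiftedObs hk]; exact hM.posDef_Cyy hk N)
    filter_upwards [this] with ω hω hkb
    simp only [hM.covMat_shiftedObs hk] at hω
    simp only [ψ, yVec_ofLp_of_kb_eq hkb]
    exact hω
  have h2 := (Finset.eventually_all (Finset.Icc 1 M.Kb)).2 h
  filter_upwards [h2, hM.ae_kb_mem] with ω hω hkb
  exact hω _ hkb rfl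

lemma measurable_kb_fiber (hM : M.IsGaussianModel μ) (m : ℕ) : MeasurableSet (M.kb ⁻¹' {m}) :=
  hM.kb_measurable (measurableSet_singleton m)

lemma measurable_shift (hM : M.IsGaussianModel μ) {X : ℤ → Ω → ℂ} (hX : ∀ n, Measurable (X n))
    (n : ℤ) : Measurable fun ω => X (n - M.kb ω) ω := by
  have h : Measurable fun p : ℕ × Ω => X (n - p.1) p.2 :=
    measurable_from_prod_countable_right fun k => hX (n - k)
  exact h.comp (hM.kb_measurable.prodMk measurable_id)

lemma measurable_yVec (hM : M.IsGaussianModel μ) (N : ℕ) : Measurable (M.yVec N) := by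
  have hb := fun n => hM.measurable_shift hM.b_gaussian.measurable n
  have hw := hM.w_gaussian.measurable
  have hs := hM.s_gaussian.measurable
  have : Measurable fun ω => (WithLp.toLp 2 fun i : Fin N =>
      M.s (((i : ℕ) : ℤ) + 1) ω + M.v (((i : ℕ) : ℤ) + 1) ω : EuclideanSpace ℂ (Fin N)) := by
    refine (WithLp.measurable_toLp 2 _).comp (measurable_pi_lambda _ fun i => ?_)
    unfold v
    fun_prop
  exact this

/-- The filtration generated by the successive observations. -/
noncomputable def obsFiltration (hM : M.IsGaussianModel μ) :
    Filtration ℕ (inferInstance : MeasurableSpace Ω) where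
  seq := M.obs
  mono' := by
    intro N N' h
    rw [obs, ← measurable_iff_comap_le]
    have e : M.yVec N = (fun y : EuclideanSpace ℂ (Fin N') => (WithLp.toLp 2 fun i : Fin N =>
        y (Fin.castLE h i) : EuclideanSpace ℂ (Fin N))) ∘ M.yVec N' := rfl
    rw [e]
    refine Measurable.comp ?_ (comap_measurable _)
    refine (WithLp.measurable_toLp 2 _).comp (measurable_pi_lambda _ fun i => ?_)
    fun_prop
  le' N := (hM.measurable_yVec N).comap_le

omit [MeasurableSpace Ω] in
lemma measurable_obs_of_comp {N : ℕ} {E : Type*} [MeasurableSpace E]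
    {f : EuclideanSpace ℂ (Fin N) → E} (hf : Measurable f) :
    Measurable[M.obs N] fun ω => f (M.yVec N ω) :=
  hf.comp (comap_measurable _)

lemma measurable_ψ (M : Mixture Ω) (μ : Measure Ω) (N k : ℕ) : Measurable[M.obs N] (M.ψ μ N k) := by
  refine measurable_obs_of_comp (f := fun y : EuclideanSpace ℂ (Fin N) =>
    (1 / (N : ℂ)) * (star y.ofLp ⬝ᵥ ((M.Cyy μ N k)⁻¹ *ᵥ y.ofLp)) - 1) ?_
  have : Continuous fun y : EuclideanSpace ℂ (Fin N) =>
    (1 / (N : ℂ)) * (star y.ofLp ⬝ᵥ ((M.Cyy μ N k)⁻¹ *ᵥ y.ofLp)) - 1 := by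
    simp only [dotProduct, Matrix.mulVec, Pi.star_apply]
    fun_prop
  exact this.measurable

/-- Under unique detectability the posterior probability of each shift tends to the indicator of
its being the true one. The event `ψ N k → 0` depends only on the full observation and coincides
almost surely with `kb = k`, so this is Lévy's upward theorem. -/
lemma tendsto_posterior (hM : M.IsGaussianModel μ) (hUSC : M.USC μ) {k : ℕ}
    (hk : k ∈ Finset.Icc 1 M.Kb) :
    ∀ᵐ ω ∂μ, Tendsto (fun N => M.posterior μ N k ω) atTop
      (𝓝 ((M.kb ⁻¹' {k}).indicator (fun _ => 1) ω)) := by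
  have hprob := hM.s_gaussian.gaussian.isProbabilityMeasure
  set A : Set Ω := {ω | Tendsto (fun N : ℕ => ‖M.ψ μ N k ω‖) atTop (𝓝 0)} with hA
  set g : Ω → ℝ := (M.kb ⁻¹' {k}).indicator (fun _ => 1) with hg
  have hsup : (⨆ n, hM.obsFiltration n) ≤ (inferInstance : MeasurableSpace Ω) :=
    iSup_le fun n => hM.obsFiltration.le n
  have hAm : MeasurableSet[⨆ n, hM.obsFiltration n] A := by
    exact measurableSet_tendsto (𝓝 0) fun N =>
      measurable_norm.comp
        ((measurable_ψ M μ N k).mono (le_iSup (fun n => hM.obsFiltration n) N) le_rfl)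
  have hAk : g =ᵐ[μ] A.indicator (fun _ => 1) := by
    filter_upwards [hM.tendsto_ψ_kb, hUSC] with ω h1 h2
    by_cases hω : M.kb ω = k
    · have : ω ∈ A := by rw [← hω] at hA; rw [hA]; exact h1
      rw [hg, Set.indicator_of_mem (show ω ∈ M.kb ⁻¹' {k} from hω), Set.indicator_of_mem this]
    · have : ω ∉ A := fun hωA => h2 ⟨k, hk, Ne.symm hω, hωA⟩
      rw [hg, Set.indicator_of_notMem (show ω ∉ M.kb ⁻¹' {k} from hω),
        Set.indicator_of_notMem this]
  have hAsm : StronglyMeasurable[⨆ n, hM.obsFiltration n] (A.indicator fun _ => (1 : ℝ)) :=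
    stronglyMeasurable_const.indicator hAm
  have hint : Integrable (A.indicator fun _ => (1 : ℝ)) μ :=
    (integrable_const 1).indicator (hsup _ hAm)
  have hce : μ[g | ⨆ n, hM.obsFiltration n] =ᵐ[μ] g := by
    refine (condExp_congr_ae hAk).trans ?_
    rw [condExp_of_stronglyMeasurable hsup hAsm hint]
    exact hAk.symm
  filter_upwards [tendsto_ae_condExp (ℱ := hM.obsFiltration) g, hce] with ω h1 h2
  rw [h2] at h1
  exact h1

/-- The maximum a posteriori estimator is eventually correct, almost surely. -/
lemma eventually_map_eq_kb (hM : M.IsGaussianModel μ) (hUSC : M.USC μ) {kMAP : ℕ → Ω → ℕ}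
    (hMAP : ∀ N, M.IsMAP μ N (kMAP N)) : ∀ᵐ ω ∂μ, ∀ᶠ N in atTop, kMAP N ω = M.kb ω := by
  have h1 := (Finset.eventually_all (Finset.Icc 1 M.Kb)).2 fun k hk => hM.tendsto_posterior hUSC hk
  have h2 := ae_all_iff.2 fun N => (hMAP N).argmax
  filter_upwards [h1, h2, hM.ae_kb_mem] with ω h1 h2 h3
  have ev : ∀ᶠ N in atTop, ∀ k ∈ Finset.Icc 1 M.Kb,
      (k = M.kb ω → 1 / 2 < M.posterior μ N k ω) ∧ (k ≠ M.kb ω → M.posterior μ N k ω < 1 / 2) := by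
    refine (Finset.eventually_all _).2 fun k hk => ?_
    have h := h1 k hk
    by_cases hkb : k = M.kb ω
    · rw [Set.indicator_of_mem (show ω ∈ M.kb ⁻¹' {k} from hkb.symm)] at h
      filter_upwards [h.eventually_const_lt (show (1 / 2 : ℝ) < 1 by norm_num)] with N hN
      exact ⟨fun _ => hN, fun hne => absurd hkb hne⟩
    · rw [Set.indicator_of_notMem (show ω ∉ M.kb ⁻¹' {k} from Ne.symm hkb)] at h
      filter_upwards [h.eventually_lt_const (show (0 : ℝ) < 1 / 2 by norm_num)] with N hN
      exact ⟨fun he => absurd he hkb, fun _ => hN⟩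
  filter_upwards [ev] with N hN
  by_contra hne
  have ha := (hN _ (h2 N).1).2 hne
  have hb := (hN _ h3).1 rfl
  have hc := (h2 N).2 _ h3
  linarith

lemma measurable_map {N : ℕ} {k : Ω → ℕ} (hM : M.IsGaussianModel μ) (hk : M.IsMAP μ N k) :
    Measurable k := hk.measurable.mono (hM.obsFiltration.le N) le_rfl

/-- The error probability of the maximum a posteriori estimator vanishes asymptotically. -/
lemma tendsto_measureReal_map_ne_kb (hM : M.IsGaussianModel μ) (hUSC : M.USC μ)
    {kMAP : ℕ → Ω → ℕ} (hMAP : ∀ N, M.IsMAP μ N (kMAP N)) :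
    Tendsto (fun N => μ.real {ω | kMAP N ω ≠ M.kb ω}) atTop (𝓝 0) := by
  have hprob := hM.s_gaussian.gaussian.isProbabilityMeasure
  have hmeas : ∀ N, MeasurableSet {ω | kMAP N ω ≠ M.kb ω} := fun N =>
    (measurableSet_eq_fun (hM.measurable_map (hMAP N)) hM.kb_measurable).compl
  have h := tendsto_integral_of_dominated_convergence (μ := μ)
    (F := fun N => {ω | kMAP N ω ≠ M.kb ω}.indicator fun _ => (1 : ℝ)) (f := fun _ => 0)
    (fun _ => 1) (fun N => (measurable_const.indicator (hmeas N)).aestronglyMeasurable)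
    (integrable_const 1) (fun N => .of_forall fun ω => ?_) ?_
  · simpa [integral_indicator_const _ (hmeas _)] using h
  · refine (norm_indicator_le_norm_self _ _).trans (by simp)
  · filter_upwards [hM.eventually_map_eq_kb hUSC hMAP] with ω hω
    refine tendsto_const_nhds.congr' ?_
    filter_upwards [hω] with N hN
    simp [hN]

/-! ### Uniform boundedness of the linear estimators -/

open scoped ComplexOrder in
/-- The linear estimators have operator norms bounded uniformly in the observation length. -/
lemma norm_lmmse_sq_le (hM : M.IsGaussianModel μ) {Λ : ℝ} (hΛ0 : 0 < Λ)
    (hΛ : ∀ (N : ℕ) (c : Fin N → ℂ),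
      (star c ⬝ᵥ (M.Css μ N *ᵥ c)).re ≤ Λ * ∑ i, ‖c i‖ ^ 2)
    {m : ℕ} (hm : m ∈ Finset.Icc 1 M.Kb) (N : ℕ) (ω : Ω) :
    ‖M.lmmse μ N m ω‖ ^ 2 ≤ (Λ * M.ρSNR) ^ 2 * ‖M.yVec N ω‖ ^ 2 := by
  rw [EuclideanSpace.norm_sq_eq, EuclideanSpace.norm_sq_eq]
  set y := (M.yVec N ω).ofLp
  have hdet : IsUnit (M.Cyy μ N m).det :=
    (Matrix.isUnit_iff_isUnit_det _).1 (hM.posDef_Cyy hm N).isUnit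
  set z := (M.Cyy μ N m)⁻¹ *ᵥ y with hz
  have hCz : M.Cyy μ N m *ᵥ z = y := by
    rw [hz, Matrix.mulVec_mulVec, Matrix.mul_nonsing_inv _ hdet, Matrix.one_mulVec]
  have e : (M.lmmse μ N m ω).ofLp = M.Css μ N *ᵥ z := by
    rw [lmmse, hz, Matrix.mulVec_mulVec]; rfl
  rw [e]
  have b1 := Matrix.IsHermitian.sum_norm_sq_mulVec_le (C := M.Css μ N)
    (by rw [Css_eq]; exact covMat_self_isHermitian _) (fun x => by
      rw [Css_eq, star_dotProduct_covMat_mulVec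
        fun i => hM.memLp_of_mem_span (signal_mem_span M N i)]
      exact integral_nonneg fun ω => by positivity) hΛ0 (hΛ N) z
  obtain ⟨q, hq, hle⟩ := hM.le_quadForm_Cyy hm z
  have b2 := sum_norm_sq_le_of_le_quadForm (C := M.Cyy μ N m) (inv_pos.2 hM.ρSNR_pos) z
    (by rw [hq]; exact hle)
  rw [hCz, inv_inv] at b2
  calc _ ≤ Λ ^ 2 * ∑ i, ‖z i‖ ^ 2 := b1
    _ ≤ Λ ^ 2 * (M.ρSNR ^ 2 * ∑ i, ‖y i‖ ^ 2) := by gcongr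
    _ = _ := by ring

end IsGaussianModel

/-! ### Linear estimation errors -/

/-- The matrix `C_ss C_yy(m)⁻¹` of the LMMSE estimator for the shift `m`. -/
noncomputable def lmmseMatrix (M : Mixture Ω) (μ : Measure Ω) (N m : ℕ) :
    Matrix (Fin N) (Fin N) ℂ := M.Css μ N * (M.Cyy μ N m)⁻¹

/-- The error of the LMMSE estimator for the shift `m` when `m` is the true shift. -/
noncomputable def residual (M : Mixture Ω) (μ : Measure Ω) (m N : ℕ) : Fin N → Ω → ℂ :=
  fun i ω => linImage (M.lmmseMatrix μ N m) (M.shiftedObs m N) i ω - M.signal N i ω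

/-- The LMMSE estimator informed of the true shift. -/
noncomputable def oracle (M : Mixture Ω) (μ : Measure Ω) (N : ℕ) (ω : Ω) :
    EuclideanSpace ℂ (Fin N) := M.lmmse μ N (M.kb ω) ω

lemma lmmse_apply (N m : ℕ) (ω : Ω) (i : Fin N) :
    M.lmmse μ N m ω i = (M.lmmseMatrix μ N m *ᵥ (M.yVec N ω).ofLp) i := rfl

/-- The shifted observation as a function of the sources. -/
noncomputable def obsOfSources (M : Mixture Ω) (m N : ℕ) (u : Fin 3 × ℤ → ℂ) :
    EuclideanSpace ℂ (Fin N) :=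
  WithLp.toLp 2 fun i => u (0, ((i : ℕ) : ℤ) + 1) + M.noiseOfSources m N u i

omit [MeasurableSpace Ω] in
@[fun_prop]
lemma measurable_obsOfSources (M : Mixture Ω) (m N : ℕ) : Measurable (M.obsOfSources m N) := by
  have := M.measurable_noiseOfSources m N
  refine (WithLp.measurable_toLp 2 _).comp (measurable_pi_lambda _ fun i => ?_)
  fun_prop

omit [MeasurableSpace Ω] in
lemma yVec_eq_obsOfSources {m : ℕ} {ω : Ω} (h : M.kb ω = m) (N : ℕ) :
    M.yVec N ω = M.obsOfSources m N fun p => M.sources p ω := by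
  ext i
  rw [yVec_apply_of_kb_eq h]
  rfl

lemma measurable_lmmse (M : Mixture Ω) (μ : Measure Ω) (N m : ℕ) :
    Measurable[M.obs N] (M.lmmse μ N m) := by
  refine IsGaussianModel.measurable_obs_of_comp (f := fun y : EuclideanSpace ℂ (Fin N) =>
    WithLp.toLp 2 ((M.Css μ N * (M.Css μ N + M.Cvv μ N m)⁻¹) *ᵥ y.ofLp)) ?_
  have : Continuous fun y : EuclideanSpace ℂ (Fin N) =>
      (WithLp.toLp 2 ((M.Css μ N * (M.Css μ N + M.Cvv μ N m)⁻¹) *ᵥ y.ofLp) :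
        EuclideanSpace ℂ (Fin N)) := by fun_prop
  exact this.measurable

namespace IsGaussianModel

lemma memLp_sVec (hM : M.IsGaussianModel μ) (N : ℕ) : MemLp (M.sVec N) 2 μ :=
  MemLp.of_eval_piLp fun i => hM.memLp_of_mem_span (signal_mem_span M N i)

lemma memLp_yVec_apply (hM : M.IsGaussianModel μ) {N : ℕ} (i : Fin N) {p : ℝ≥0∞} (hp : p ≠ ∞) :
    MemLp (fun ω => M.yVec N ω i) p μ := by
  have e : (fun ω => M.yVec N ω i) = fun ω => M.shiftedObs (M.kb ω) N i ω :=
    funext fun ω => yVec_apply_of_kb_eq rfl N i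
  have hmeas : Measurable fun ω => M.yVec N ω i := by
    have := hM.measurable_yVec N
    fun_prop
  rw [e] at hmeas ⊢
  exact memLp_selection (G := fun m => M.shiftedObs m N i) (s := Finset.Icc 1 M.Kb)
    (fun m _ => ((hM.isProperGaussian_shiftedObs m N).gaussian.hasGaussianLaw_eval i).memLp hp)
    hM.ae_kb_mem hmeas.aestronglyMeasurable

lemma memLp_lmmse (hM : M.IsGaussianModel μ) (N m : ℕ) : MemLp (M.lmmse μ N m) 2 μ := by
  refine MemLp.of_eval_piLp fun i => ?_
  simp only [lmmse_apply, Matrix.mulVec, dotProduct]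
  exact memLp_finsetSum _ fun j _ => (hM.memLp_yVec_apply j (by norm_num)).const_mul _

lemma memLp_lmmse_selection (hM : M.IsGaussianModel μ) (N : ℕ) {k : Ω → ℕ} (hk : Measurable k)
    (hk' : ∀ᵐ ω ∂μ, k ω ∈ Finset.Icc 1 M.Kb) : MemLp (fun ω => M.lmmse μ N (k ω) ω) 2 μ :=
  memLp_selection (fun m _ => hM.memLp_lmmse N m) hk'
    (measurable_selection (fun m => (measurable_lmmse M μ N m).mono (hM.obsFiltration.le N) le_rfl)
      hk).aestronglyMeasurable

lemma memLp_oracle (hM : M.IsGaussianModel μ) (N : ℕ) : MemLp (M.oracle μ N) 2 μ :=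
  hM.memLp_lmmse_selection N hM.kb_measurable hM.ae_kb_mem

lemma residual_mem_span (M : Mixture Ω) (μ : Measure Ω) (m N : ℕ) (i : Fin N) :
    M.residual μ m N i ∈ Submodule.span ℂ (Set.range M.sources) := by
  refine sub_mem ?_ (signal_mem_span M N i)
  exact Submodule.span_le.2 (by rintro _ ⟨j, rfl⟩; exact shiftedObs_mem_span M m N j)
    (linImage_mem_span _ _ i)

open scoped ComplexOrder in
lemma integral_residual_mul_star_shiftedObs (hM : M.IsGaussianModel μ) {m : ℕ}
    (hm : m ∈ Finset.Icc 1 M.Kb) (N : ℕ) (i j : Fin N) :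
    ∫ ω, M.residual μ m N i ω * star (M.shiftedObs m N j ω) ∂μ = 0 := by
  have hY := (hM.isProperGaussian_shiftedObs m N).memLp
  have hdet : IsUnit (M.Cyy μ N m).det :=
    (Matrix.isUnit_iff_isUnit_det _).1 (hM.posDef_Cyy hm N).isUnit
  have h1 := covMat_linImage hY hY (M.lmmseMatrix μ N m)
    (1 : Matrix (Fin N) (Fin N) ℂ)
  have e1 : linImage (1 : Matrix (Fin N) (Fin N) ℂ) (M.shiftedObs m N) = M.shiftedObs m N := by
    ext i ω; simp [linImage]
  have hL : M.lmmseMatrix μ N m * M.Cyy μ N m = M.Css μ N := by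
    rw [lmmseMatrix, Matrix.mul_assoc, Matrix.nonsing_inv_mul _ hdet, mul_one]
  rw [e1, hM.covMat_shiftedObs hm, hL, Matrix.conjTranspose_one, mul_one,
    ← hM.covMat_signal_shiftedObs m N] at h1
  have h2 := congrFun (congrFun h1 i) j
  simp only [covMat, Matrix.of_apply] at h2
  simp only [residual, sub_mul]
  rw [integral_sub ((memLp_linImage hY _ i).integrable_mul_star (hY j))
    ((hM.memLp_of_mem_span (signal_mem_span M N i)).integrable_mul_star (hY j)), sub_eq_zero]
  exact h2

/-- The error of the LMMSE estimator is independent of the observation: both are jointly proper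
Gaussian and they are uncorrelated. -/
lemma indepFun_shiftedObs_residual (hM : M.IsGaussianModel μ) {m : ℕ}
    (hm : m ∈ Finset.Icc 1 M.Kb) (N : ℕ) :
    IndepFun (fun ω i => M.shiftedObs m N i ω) (fun ω i => M.residual μ m N i ω) μ := by
  refine IsProperGaussian.indepFun_of_covMat_eq_zero
    (hM.isProperGaussian_sources.of_mem_span ?_) fun i j => ?_
  · rintro (i | i)
    exacts [shiftedObs_mem_span M m N i, residual_mem_span M μ m N i]
  · have h : (∫ ω, M.residual μ m N j ω * star (M.shiftedObs m N i ω) ∂μ) = 0 :=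
      hM.integral_residual_mul_star_shiftedObs hm N j i
    have h2 := congrFun (congrFun (covMat_conjTranspose (μ := μ) (M.residual μ m N)
      (M.shiftedObs m N)) i) j
    simp only [covMat, Matrix.conjTranspose_apply, Matrix.of_apply, h, star_zero] at h2
    exact h2.symm

/-- Any function of the observation is orthogonal to the error of the informed estimator on each
event `kb = m`. The function need not be integrable: expectations of products of independent
variables factor unconditionally, and the other factor has mean zero. -/
lemma setIntegral_mul_star_error (hM : M.IsGaussianModel μ) {m : ℕ} (hm : m ∈ Finset.Icc 1 M.Kb)
    (N : ℕ) {f : EuclideanSpace ℂ (Fin N) → ℂ} (hf : Measurable f) (i : Fin N) :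
    ∫ ω in M.kb ⁻¹' {m}, f (M.yVec N ω) * star (M.lmmse μ N m ω i - M.sVec N ω i) ∂μ = 0 := by
  rw [hM.setIntegral_kb_eq hm (fun u => f (M.obsOfSources m N u) *
    star ((M.lmmseMatrix μ N m *ᵥ (M.obsOfSources m N u).ofLp) i - u (0, ((i : ℕ) : ℤ) + 1)))]
  · change _ • ∫ ω, f (WithLp.toLp 2 fun i => M.shiftedObs m N i ω) *
      star (M.residual μ m N i ω) ∂μ = 0
    have hR := hM.memLp_of_mem_span (residual_mem_span M μ m N i)
    have hY : Measurable fun ω => f (WithLp.toLp 2 fun i => M.shiftedObs m N i ω) :=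
      hf.comp ((WithLp.measurable_toLp 2 _).comp
        (measurable_pi_lambda _ (hM.isProperGaussian_shiftedObs m N).measurable))
    have hind : IndepFun (fun ω => f (WithLp.toLp 2 fun i => M.shiftedObs m N i ω))
        (fun ω => star (M.residual μ m N i ω)) μ :=
      (hM.indepFun_shiftedObs_residual hm N).comp
        (φ := fun y => f (WithLp.toLp 2 y)) (ψ := fun r : Fin N → ℂ => star (r i))
        (hf.comp (WithLp.measurable_toLp 2 _))
        (continuous_star.measurable.comp (measurable_pi_apply i))
    have h0 : ∫ ω, star (M.residual μ m N i ω) ∂μ = 0 := by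
      have h := (hM.isProperGaussian_sources.of_mem_span (residual_mem_span M μ m N)).mean_zero i
      have h2 := integral_conj (μ := μ) (f := M.residual μ m N i)
      rw [h] at h2
      simpa using h2
    rw [hind.integral_fun_mul_eq_mul_integral hY.aestronglyMeasurable
      hR.star.aestronglyMeasurable, h0, mul_zero, smul_zero]
  · have hobs := M.measurable_obsOfSources m N
    have h1 : Measurable fun u : Fin 3 × ℤ → ℂ =>
        (M.lmmseMatrix μ N m *ᵥ (M.obsOfSources m N u).ofLp) i := by
      have hlin : Measurable fun y : EuclideanSpace ℂ (Fin N) =>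
          (M.lmmseMatrix μ N m *ᵥ y.ofLp) i := by
        simp only [Matrix.mulVec, dotProduct]
        fun_prop
      exact hlin.comp hobs
    exact (hf.comp hobs).mul (continuous_star.measurable.comp (h1.sub (measurable_pi_apply _)))
  · intro ω hω
    rw [lmmse_apply, yVec_eq_obsOfSources hω]
    rfl

/-- Pythagoras: the mean squared error of an estimator is its mean squared distance to the
estimator informed of the shift, plus the error of the latter. -/
lemma integral_norm_sub_sVec_sq (hM : M.IsGaussianModel μ) {N : ℕ}
    {T : Ω → EuclideanSpace ℂ (Fin N)} (hT : Measurable[M.obs N] T) (hT2 : MemLp T 2 μ) :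
    ∫ ω, ‖T ω - M.sVec N ω‖ ^ 2 ∂μ
      = ∫ ω, ‖T ω - M.oracle μ N ω‖ ^ 2 ∂μ + ∫ ω, ‖M.oracle μ N ω - M.sVec N ω‖ ^ 2 ∂μ := by
  obtain ⟨h, hh, rfl⟩ := hT.exists_eq_measurable_comp
  have hO := hM.memLp_oracle N
  have hs := hM.memLp_sVec N
  have c1 : ∀ i, MemLp (fun ω => (h ∘ M.yVec N) ω i - M.oracle μ N ω i) 2 μ := fun i =>
    (hT2.eval_piLp i).sub (hO.eval_piLp i)
  have c2 : ∀ i, MemLp (fun ω => M.oracle μ N ω i - M.sVec N ω i) 2 μ := fun i =>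
    (hO.eval_piLp i).sub (hs.eval_piLp i)
  have c3 : ∀ i, MemLp (fun ω => (h ∘ M.yVec N) ω i - M.sVec N ω i) 2 μ := fun i =>
    (hT2.eval_piLp i).sub (hs.eval_piLp i)
  simp only [EuclideanSpace.norm_sq_eq, PiLp.sub_apply]
  rw [integral_finsetSum _ fun i _ => (c1 i).integrable_norm_pow (by norm_num),
    integral_finsetSum _ fun i _ => (c2 i).integrable_norm_pow (by norm_num),
    integral_finsetSum _ fun i _ => (c3 i).integrable_norm_pow (by norm_num),
    ← Finset.sum_add_distrib]
  refine Finset.sum_congr rfl fun i _ => ?_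
  rw [← integral_norm_add_sq_of_orthogonal (c1 i) (c2 i)]
  · simp only [sub_add_sub_cancel]
  · rw [hM.integral_eq_sum_setIntegral ((c1 i).integrable_mul_star (c2 i))]
    refine Finset.sum_eq_zero fun m hm => ?_
    have hf : Measurable fun y : EuclideanSpace ℂ (Fin N) =>
        h y i - (M.lmmseMatrix μ N m *ᵥ y.ofLp) i := by
      simp only [Matrix.mulVec, dotProduct]
      fun_prop
    rw [← hM.setIntegral_mul_star_error hm N hf i]
    refine setIntegral_congr_fun (hM.measurable_kb_fiber m) fun ω hω => ?_
    obtain rfl : M.kb ω = m := hω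
    rfl

end IsGaussianModel

/-- A bound on the power of the observation, uniform in time and in the shift; the
factor `3` is that of `‖x + y + z‖ ^ 2 ≤ 3 * (‖x‖ ^ 2 + ‖y‖ ^ 2 + ‖z‖ ^ 2)`. -/
noncomputable def powerBound (M : Mixture Ω) : ℝ :=
  3 * (M.Ks + M.ρSIR⁻¹ * M.Kb + M.ρSNR⁻¹)

namespace IsGaussianModel

/-! ### The informed error grows linearly -/

/-- Each coordinate of the informed error is a fixed fraction of the power of the signal: a linear
estimator with small coefficients misses the signal, one with large coefficients lets the white
noise through. -/
lemma power_le_residual (hM : M.IsGaussianModel μ) {Λ : ℝ} (hΛ0 : 0 < Λ)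
    (hΛ : ∀ (N : ℕ) (c : Fin N → ℂ),
      (star c ⬝ᵥ (M.Css μ N *ᵥ c)).re ≤ Λ * ∑ i, ‖c i‖ ^ 2) (m N : ℕ) (i : Fin N) :
    ∫ ω, ‖M.signal N i ω‖ ^ 2 ∂μ
      ≤ 2 * (1 + Λ * M.ρSNR) * ∫ ω, ‖M.residual μ m N i ω‖ ^ 2 ∂μ := by
  have hρ := hM.ρSNR_pos
  set β : Fin N → ℂ := fun j => -M.lmmseMatrix μ N m i j with hβ
  have hs := hM.memLp_of_mem_span (signal_mem_span M N i)
  have hsj := fun j => hM.memLp_of_mem_span (signal_mem_span M N j)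
  have h1 := hM.integral_norm_sq_add_noise_le m N (p := M.signal N i)
    (Submodule.subset_span ⟨_, rfl⟩) β
  have e1 : ∀ ω, M.signal N i ω + ∑ j, β j * M.shiftedObs m N j ω = -M.residual μ m N i ω := by
    intro ω
    simp only [residual, linImage_apply, hβ, neg_mul, Finset.sum_neg_distrib]
    ring
  simp_rw [e1, norm_neg] at h1
  have h2 : ∫ ω, ‖∑ j, β j * M.signal N j ω‖ ^ 2 ∂μ ≤ Λ * ∑ j, ‖β j‖ ^ 2 := by
    have h := hΛ N (fun j => star (β j))
    rw [Css_eq, star_dotProduct_covMat_mulVec hsj, Complex.ofReal_re] at h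
    simpa only [star_star, norm_star] using h
  have hL : MemLp (fun ω => ∑ j, β j * M.signal N j ω) 2 μ :=
    memLp_finsetSum _ fun j _ => (hsj j).const_mul _
  have h3 : ∫ ω, ‖M.signal N i ω‖ ^ 2 ∂μ ≤
      2 * ∫ ω, ‖M.signal N i ω + ∑ j, β j * M.signal N j ω‖ ^ 2 ∂μ
        + 2 * ∫ ω, ‖∑ j, β j * M.signal N j ω‖ ^ 2 ∂μ := by
    have i1 : Integrable (fun ω => ‖M.signal N i ω + ∑ j, β j * M.signal N j ω‖ ^ 2) μ :=
      (hs.add hL).integrable_norm_pow (by norm_num)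
    have i2 : Integrable (fun ω => ‖∑ j, β j * M.signal N j ω‖ ^ 2) μ :=
      hL.integrable_norm_pow (by norm_num)
    rw [← integral_const_mul, ← integral_const_mul, ← integral_add (i1.const_mul 2) (i2.const_mul 2)]
    refine integral_mono (hs.integrable_norm_pow (by norm_num))
      ((i1.const_mul 2).add (i2.const_mul 2)) fun ω => ?_
    have := norm_sub_le (M.signal N i ω + ∑ j, β j * M.signal N j ω) (∑ j, β j * M.signal N j ω)
    rw [add_sub_cancel_right] at this
    have h' := pow_le_pow_left₀ (norm_nonneg _) this 2
    refine h'.trans ?_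
    nlinarith [sq_nonneg (‖M.signal N i ω + ∑ j, β j * M.signal N j ω‖
      - ‖∑ j, β j * M.signal N j ω‖)]
  set R := ∫ ω, ‖M.residual μ m N i ω‖ ^ 2 ∂μ
  set P := ∫ ω, ‖M.signal N i ω + ∑ j, β j * M.signal N j ω‖ ^ 2 ∂μ with hP
  have hP0 : 0 ≤ P := integral_nonneg fun ω => by positivity
  set B := ∑ j, ‖β j‖ ^ 2
  have hB0 : 0 ≤ B := Finset.sum_nonneg fun j _ => by positivity
  have h4 : B ≤ M.ρSNR * R := by
    have : M.ρSNR * (M.ρSNR⁻¹ * B) ≤ M.ρSNR * R := by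
      gcongr
      linarith
    rwa [mul_inv_cancel_left₀ hρ.ne'] at this
  have h5 : P ≤ R := by
    have : 0 ≤ M.ρSNR⁻¹ * B := by positivity
    linarith
  have h6 : Λ * B ≤ Λ * (M.ρSNR * R) := by gcongr
  linarith

/-- The oracle error grows at least linearly, since the power of the signal averages to one. -/
lemma le_oracle_error (hM : M.IsGaussianModel μ) {Λ : ℝ} (hΛ0 : 0 < Λ)
    (hΛ : ∀ (N : ℕ) (c : Fin N → ℂ),
      (star c ⬝ᵥ (M.Css μ N *ᵥ c)).re ≤ Λ * ∑ i, ‖c i‖ ^ 2) {N : ℕ} (hN : M.Ks ≤ N) :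
    (4 * (1 + Λ * M.ρSNR))⁻¹ * N ≤ ∫ ω, ‖M.oracle μ N ω - M.sVec N ω‖ ^ 2 ∂μ := by
  have hρ := hM.ρSNR_pos
  have hK : (0 : ℝ) < M.Kb := by exact_mod_cast hM.Kb_pos
  have c2 : ∀ i, MemLp (fun ω => M.oracle μ N ω i - M.sVec N ω i) 2 μ := fun i =>
    ((hM.memLp_oracle N).eval_piLp i).sub ((hM.memLp_sVec N).eval_piLp i)
  have hcoord : ∀ i : Fin N, (2 * (1 + Λ * M.ρSNR))⁻¹ * ∫ ω, ‖M.signal N i ω‖ ^ 2 ∂μ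
      ≤ ∫ ω, ‖M.oracle μ N ω i - M.sVec N ω i‖ ^ 2 ∂μ := by
    intro i
    rw [hM.integral_eq_sum_setIntegral ((c2 i).integrable_norm_pow (by norm_num))]
    have hset : ∀ m ∈ Finset.Icc 1 M.Kb,
        (M.Kb : ℝ)⁻¹ * ((2 * (1 + Λ * M.ρSNR))⁻¹ * ∫ ω, ‖M.signal N i ω‖ ^ 2 ∂μ)
          ≤ ∫ ω in M.kb ⁻¹' {m}, ‖M.oracle μ N ω i - M.sVec N ω i‖ ^ 2 ∂μ := by
      intro m hm
      rw [hM.setIntegral_kb_eq hm (fun u => ‖(M.lmmseMatrix μ N m *ᵥ (M.obsOfSources m N u).ofLp) i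
        - u (0, ((i : ℕ) : ℤ) + 1)‖ ^ 2)]
      · change _ ≤ (M.Kb : ℝ)⁻¹ * ∫ ω, ‖M.residual μ m N i ω‖ ^ 2 ∂μ
        gcongr
        rw [inv_mul_le_iff₀ (by positivity)]
        exact hM.power_le_residual hΛ0 hΛ m N i
      · have hlin : Measurable fun y : EuclideanSpace ℂ (Fin N) =>
            (M.lmmseMatrix μ N m *ᵥ y.ofLp) i := by
          simp only [Matrix.mulVec, dotProduct]
          fun_prop
        exact (((hlin.comp (M.measurable_obsOfSources m N)).sub
          (measurable_pi_apply _)).norm).pow_const 2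
      · intro ω hω
        obtain rfl : M.kb ω = m := hω
        rw [oracle, lmmse_apply, yVec_eq_obsOfSources rfl]
        rfl
    refine le_trans (le_of_eq ?_) (Finset.sum_le_sum hset)
    rw [Finset.sum_const, Nat.card_Icc, add_tsub_cancel_right, nsmul_eq_mul,
      mul_inv_cancel_left₀ hK.ne']
  have hpow := hM.s_cyclo.le_sum_power hM.s_power hM.Ks_pos hN
  simp only [EuclideanSpace.norm_sq_eq, PiLp.sub_apply]
  rw [integral_finsetSum _ fun i _ => (c2 i).integrable_norm_pow (by norm_num)]
  calc (4 * (1 + Λ * M.ρSNR))⁻¹ * N = (2 * (1 + Λ * M.ρSNR))⁻¹ * (N / 2) := by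
        field_simp; ring
    _ ≤ (2 * (1 + Λ * M.ρSNR))⁻¹ * ∑ i : Fin N, ∫ ω, ‖M.signal N i ω‖ ^ 2 ∂μ := by
        gcongr
        exact hpow
    _ ≤ _ := by
        rw [Finset.mul_sum]
        exact Finset.sum_le_sum fun i _ => hcoord i

/-! ### The cost of a wrong shift -/

lemma integral_norm_sq_shiftedObs_le (hM : M.IsGaussianModel μ) (m N : ℕ) (i : Fin N) :
    ∫ ω, ‖M.shiftedObs m N i ω‖ ^ 2 ∂μ ≤ M.powerBound := by
  set n : ℤ := ((i : ℕ) : ℤ) + 1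
  have hs := hM.s_cyclo.power_le hM.s_power hM.Ks_pos n
  have hb := hM.b_cyclo.power_le hM.b_power hM.Kb_pos (n - m)
  have hw : ∫ ω, ‖M.w n ω‖ ^ 2 ∂μ = 1 := by
    have h := hM.w_white n n
    rw [← integral_norm_sq_eq_autocov, if_pos rfl] at h
    exact_mod_cast h
  have is : Integrable (fun ω => ‖M.s n ω‖ ^ 2) μ :=
    (hM.memLp_sources (0, n)).integrable_norm_pow (by norm_num)
  have ib : Integrable (fun ω => ‖M.b (n - m) ω‖ ^ 2) μ :=
    (hM.memLp_sources (1, n - m)).integrable_norm_pow (by norm_num)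
  have iw : Integrable (fun ω => ‖M.w n ω‖ ^ 2) μ :=
    (hM.memLp_sources (2, n)).integrable_norm_pow (by norm_num)
  have iY := (hM.memLp_of_mem_span (shiftedObs_mem_span M m N i)).integrable_norm_pow
    (p := 2) (by norm_num)
  have hpt : ∀ ω, ‖M.shiftedObs m N i ω‖ ^ 2 ≤ 3 * (‖M.s n ω‖ ^ 2
      + M.ρSIR⁻¹ * ‖M.b (n - m) ω‖ ^ 2 + M.ρSNR⁻¹ * ‖M.w n ω‖ ^ 2) := by
    intro ω
    have e : M.shiftedObs m N i ω = M.s n ω + (((√M.ρSIR)⁻¹ : ℝ) * M.b (n - m) ω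
      + ((√M.ρSNR)⁻¹ : ℝ) * M.w n ω) := rfl
    have hn : ‖M.shiftedObs m N i ω‖ ≤ ‖M.s n ω‖ + ((√M.ρSIR)⁻¹ * ‖M.b (n - m) ω‖
        + (√M.ρSNR)⁻¹ * ‖M.w n ω‖) := by
      rw [e]
      refine (norm_add_le _ _).trans (add_le_add_right ((norm_add_le _ _).trans (le_of_eq ?_)) _)
      rw [norm_mul, norm_mul, Complex.norm_real, Complex.norm_real,
        Real.norm_of_nonneg (by positivity), Real.norm_of_nonneg (by positivity)]
    have e1 : M.ρSIR⁻¹ * ‖M.b (n - m) ω‖ ^ 2 = ((√M.ρSIR)⁻¹ * ‖M.b (n - m) ω‖) ^ 2 := by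
      rw [mul_pow, inv_pow, Real.sq_sqrt hM.ρSIR_pos.le]
    have e2 : M.ρSNR⁻¹ * ‖M.w n ω‖ ^ 2 = ((√M.ρSNR)⁻¹ * ‖M.w n ω‖) ^ 2 := by
      rw [mul_pow, inv_pow, Real.sq_sqrt hM.ρSNR_pos.le]
    rw [e1, e2]
    refine (pow_le_pow_left₀ (norm_nonneg _) hn 2).trans ?_
    generalize ‖M.s n ω‖ = x
    generalize (√M.ρSIR)⁻¹ * ‖M.b (n - m) ω‖ = y
    generalize (√M.ρSNR)⁻¹ * ‖M.w n ω‖ = z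
    nlinarith [sq_nonneg (x - y), sq_nonneg (y - z), sq_nonneg (x - z)]
  have i12 : Integrable (fun ω => ‖M.s n ω‖ ^ 2 + M.ρSIR⁻¹ * ‖M.b (n - m) ω‖ ^ 2) μ :=
    is.add (ib.const_mul _)
  have i3 : Integrable (fun ω => ‖M.s n ω‖ ^ 2 + M.ρSIR⁻¹ * ‖M.b (n - m) ω‖ ^ 2
      + M.ρSNR⁻¹ * ‖M.w n ω‖ ^ 2) μ := i12.add (iw.const_mul _)
  refine (integral_mono iY (i3.const_mul 3) hpt).trans ?_
  rw [integral_const_mul, integral_add i12 (iw.const_mul _), integral_add is (ib.const_mul _),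
    integral_const_mul, integral_const_mul, hw, powerBound, mul_one]
  have h1 : 0 ≤ M.ρSIR⁻¹ := (inv_pos.2 hM.ρSIR_pos).le
  gcongr

lemma integral_norm_pow_four_yVec_le (hM : M.IsGaussianModel μ) {N : ℕ} (i : Fin N) :
    ∫ ω, ‖M.yVec N ω i‖ ^ 4 ∂μ ≤ 256 * M.powerBound ^ 2 := by
  have hK : (0 : ℝ) < M.Kb := by exact_mod_cast hM.Kb_pos
  have hi : Integrable (fun ω => ‖M.yVec N ω i‖ ^ 4) μ :=
    (hM.memLp_yVec_apply i (p := 4) (by norm_num)).integrable_norm_pow (by norm_num)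
  rw [hM.integral_eq_sum_setIntegral hi]
  have hset : ∀ m ∈ Finset.Icc 1 M.Kb, ∫ ω in M.kb ⁻¹' {m}, ‖M.yVec N ω i‖ ^ 4 ∂μ
      ≤ (M.Kb : ℝ)⁻¹ * (256 * M.powerBound ^ 2) := by
    intro m hm
    rw [hM.setIntegral_kb_eq hm (fun u => ‖(M.obsOfSources m N u).ofLp i‖ ^ 4)]
    · change (M.Kb : ℝ)⁻¹ * ∫ ω, ‖M.shiftedObs m N i ω‖ ^ 4 ∂μ ≤ _
      gcongr
      refine ((hM.isProperGaussian_shiftedObs m N).integral_norm_pow_four_le i).trans ?_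
      have h := hM.integral_norm_sq_shiftedObs_le m N i
      gcongr
    · have h : Measurable fun y : EuclideanSpace ℂ (Fin N) => ‖y i‖ ^ 4 := by fun_prop
      exact h.comp (M.measurable_obsOfSources m N)
    · intro ω hω
      rw [yVec_eq_obsOfSources hω]
  refine (Finset.sum_le_sum hset).trans (le_of_eq ?_)
  rw [Finset.sum_const, Nat.card_Icc, add_tsub_cancel_right, nsmul_eq_mul,
    mul_inv_cancel_left₀ hK.ne']

/-- Energy of the observation on an event `A`; the parameter `δ` splits it between the fourth
moments and the probability of `A`. -/
lemma integral_indicator_norm_sq_yVec_le (hM : M.IsGaussianModel μ) (N : ℕ) {A : Set Ω}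
    (hA : MeasurableSet A) {δ : ℝ} (hδ : 0 < δ) :
    Integrable (A.indicator fun ω => ‖M.yVec N ω‖ ^ 2) μ ∧
    ∫ ω, A.indicator (fun ω => ‖M.yVec N ω‖ ^ 2) ω ∂μ
      ≤ N * (256 * M.powerBound ^ 2 * δ + μ.real A / δ) := by
  have hprob := hM.s_gaussian.gaussian.isProbabilityMeasure
  have e : (A.indicator fun ω => ‖M.yVec N ω‖ ^ 2)
      = fun ω => ∑ i, A.indicator (fun ω => ‖M.yVec N ω i‖ ^ 2) ω := by
    ext ω
    by_cases h : ω ∈ A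
    · simp only [Set.indicator_of_mem h, EuclideanSpace.norm_sq_eq]
    · simp [Set.indicator_of_notMem h]
  have hi : ∀ i, Integrable (A.indicator fun ω => ‖M.yVec N ω i‖ ^ 2) μ := fun i =>
    ((hM.memLp_yVec_apply i (p := 2) (by norm_num)).integrable_norm_pow (by norm_num)).indicator hA
  have hcoord : ∀ i, ∫ ω, A.indicator (fun ω => ‖M.yVec N ω i‖ ^ 2) ω ∂μ
      ≤ 256 * M.powerBound ^ 2 * δ + μ.real A / δ := by
    intro i
    have i4 : Integrable (fun ω => ‖M.yVec N ω i‖ ^ 4) μ :=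
      (hM.memLp_yVec_apply i (p := 4) (by norm_num)).integrable_norm_pow (by norm_num)
    have i1 : Integrable (A.indicator fun _ => δ⁻¹) μ := (integrable_const _).indicator hA
    calc _ ≤ ∫ ω, (‖M.yVec N ω i‖ ^ 4 * δ + A.indicator (fun _ => δ⁻¹) ω) ∂μ := by
          refine integral_mono (hi i) ((i4.mul_const δ).add i1) fun ω => ?_
          by_cases h : ω ∈ A
          · simp only [Set.indicator_of_mem h]
            have h1 := sq_nonneg (‖M.yVec N ω i‖ ^ 2 * δ - 1)
            have h2 : ‖M.yVec N ω i‖ ^ 4 * δ + δ⁻¹ - ‖M.yVec N ω i‖ ^ 2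
                = δ⁻¹ * ((‖M.yVec N ω i‖ ^ 2 * δ - 1) ^ 2 + ‖M.yVec N ω i‖ ^ 2 * δ) := by
              field_simp; ring
            have h3 : 0 ≤ δ⁻¹ * ((‖M.yVec N ω i‖ ^ 2 * δ - 1) ^ 2 + ‖M.yVec N ω i‖ ^ 2 * δ) := by
              positivity
            linarith
          · simp only [Set.indicator_of_notMem h]
            positivity
      _ = (∫ ω, ‖M.yVec N ω i‖ ^ 4 ∂μ) * δ + μ.real A / δ := by
          rw [integral_add (i4.mul_const δ) i1, integral_mul_const, integral_indicator_const _ hA,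
            smul_eq_mul, div_eq_mul_inv]
      _ ≤ _ := by
          have := hM.integral_norm_pow_four_yVec_le i
          gcongr
  rw [e]
  refine ⟨integrable_finsetSum _ fun i _ => hi i, ?_⟩
  rw [integral_finsetSum _ fun i _ => hi i]
  refine (Finset.sum_le_sum fun i _ => hcoord i).trans (le_of_eq ?_)
  rw [Finset.sum_const, Finset.card_univ, Fintype.card_fin, nsmul_eq_mul]

/-- The plug-in estimator differs from the informed one only when the estimated shift is wrong, and
then by at most a multiple of the observation. -/
lemma integral_norm_lmmse_sub_oracle_sq_le (hM : M.IsGaussianModel μ) {Λ : ℝ} (hΛ0 : 0 < Λ)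
    (hΛ : ∀ (N : ℕ) (c : Fin N → ℂ),
      (star c ⬝ᵥ (M.Css μ N *ᵥ c)).re ≤ Λ * ∑ i, ‖c i‖ ^ 2) (N : ℕ) {k : Ω → ℕ}
    (hk : Measurable k) (hk' : ∀ᵐ ω ∂μ, k ω ∈ Finset.Icc 1 M.Kb) {δ : ℝ} (hδ : 0 < δ) :
    ∫ ω, ‖M.lmmse μ N (k ω) ω - M.oracle μ N ω‖ ^ 2 ∂μ
      ≤ 4 * (Λ * M.ρSNR) ^ 2 *
        (N * (256 * M.powerBound ^ 2 * δ + μ.real {ω | k ω ≠ M.kb ω} / δ)) := by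
  set A : Set Ω := {ω | k ω ≠ M.kb ω} with hA
  have hAm : MeasurableSet A := (measurableSet_eq_fun hk hM.kb_measurable).compl
  obtain ⟨hint, hle⟩ := hM.integral_indicator_norm_sq_yVec_le N hAm hδ
  calc _ ≤ ∫ ω, 4 * (Λ * M.ρSNR) ^ 2 * A.indicator (fun ω => ‖M.yVec N ω‖ ^ 2) ω ∂μ := by
        refine integral_mono_of_nonneg (.of_forall fun ω => by positivity) (hint.const_mul _) ?_
        filter_upwards [hk', hM.ae_kb_mem] with ω h1 h2
        by_cases h : ω ∈ A
        · rw [Set.indicator_of_mem h]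
          have b1 := hM.norm_lmmse_sq_le hΛ0 hΛ h1 N ω
          have b2 := hM.norm_lmmse_sq_le hΛ0 hΛ h2 N ω
          have b3 := pow_le_pow_left₀ (norm_nonneg _)
            (norm_sub_le (M.lmmse μ N (k ω) ω) (M.oracle μ N ω)) 2
          rw [oracle] at b3 ⊢
          nlinarith [sq_nonneg (‖M.lmmse μ N (k ω) ω‖ - ‖M.lmmse μ N (M.kb ω) ω‖)]
        · have hkb : k ω = M.kb ω := by simpa [hA] using h
          rw [Set.indicator_of_notMem h, oracle, hkb]
          simp
    _ ≤ _ := by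
        rw [integral_const_mul]
        gcongr

end IsGaussianModel

end Mixture

/-- Asymptotic MMSE-optimality of the two-step estimator that first computes a MAP estimate of the
time-shift of the interference and then applies the corresponding LMMSE estimator. -/
theorem theorem1 {Ω : Type*} [MeasurableSpace Ω] (μ : Measure Ω) [IsProbabilityMeasure μ]
    (M : Mixture Ω) (hM : M.IsGaussianModel μ) (hs : M.HasBoundedSpectrum μ) (hUSC : M.USC μ)
    (kMAP : ℕ → Ω → ℕ) (hMAP : ∀ N, M.IsMAP μ N (kMAP N)) :
    Tendsto (fun N : ℕ => M.mmseError μ N / M.qlmmseError μ N (kMAP N)) atTop (𝓝 1) := by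
  obtain ⟨Λ₀, hΛ₀⟩ := hs
  set Λ : ℝ := max Λ₀ 1
  have hΛ0 : 0 < Λ := lt_of_lt_of_le one_pos (le_max_right _ _)
  have hΛ : ∀ (N : ℕ) (c : Fin N → ℂ),
      (star c ⬝ᵥ (M.Css μ N *ᵥ c)).re ≤ Λ * ∑ i, ‖c i‖ ^ 2 := fun N c =>
    (hΛ₀ N c).trans (mul_le_mul_of_nonneg_right (le_max_left _ _)
      (Finset.sum_nonneg fun i _ => by positivity))
  have hρ := hM.ρSNR_pos
  set e : ℕ → ℝ := fun N => ∫ ω, ‖M.oracle μ N ω - M.sVec N ω‖ ^ 2 ∂μ with he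
  set D : ℕ → ℝ := fun N => ∫ ω, ‖M.lmmse μ N (kMAP N ω) ω - M.oracle μ N ω‖ ^ 2 ∂μ with hD
  set P : ℕ → ℝ := fun N => μ.real {ω | kMAP N ω ≠ M.kb ω} with hP
  have hkm : ∀ N, Measurable (kMAP N) := fun N => hM.measurable_map (hMAP N)
  have hkI : ∀ N, ∀ᵐ ω ∂μ, kMAP N ω ∈ Finset.Icc 1 M.Kb := fun N =>
    (hMAP N).argmax.mono fun _ h => h.1
  have hTm : ∀ N, Measurable[M.obs N] fun ω => M.lmmse μ N (kMAP N ω) ω := fun N =>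
    measurable_selection (m := M.obs N) (fun m => Mixture.measurable_lmmse M μ N m)
      (hMAP N).measurable
  have hT2 : ∀ N, MemLp (fun ω => M.lmmse μ N (kMAP N ω) ω) 2 μ := fun N =>
    hM.memLp_lmmse_selection N (hkm N) (hkI N)
  have hq : ∀ N, M.qlmmseError μ N (kMAP N) = D N + e N := fun N =>
    hM.integral_norm_sub_sVec_sq (hTm N) (hT2 N)
  have hmm : ∀ N, e N ≤ M.mmseError μ N := fun N => by
    have h := hM.integral_norm_sub_sVec_sq (N := N) (T := M.mmse μ N)
      stronglyMeasurable_condExp.measurable ((hM.memLp_sVec N).condExp (by norm_num))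
    rw [Mixture.mmseError, h]
    exact le_add_of_nonneg_left (integral_nonneg fun ω => by positivity)
  have hmq : ∀ N, M.mmseError μ N ≤ M.qlmmseError μ N (kMAP N) := fun N =>
    integral_norm_condExp_sub_sq_le (hM.obsFiltration.le N) (hM.memLp_sVec N) (hT2 N)
      (hTm N).stronglyMeasurable
  have hD0 : ∀ N, 0 ≤ D N := fun N => integral_nonneg fun ω => by positivity
  have hP0 : Tendsto P atTop (𝓝 0) := hM.tendsto_measureReal_map_ne_kb hUSC hMAP
  -- with `δ = √P + 1 / (N + 1)` the excess error is `o(N)`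
  set δ : ℕ → ℝ := fun N => √(P N) + 1 / ((N : ℝ) + 1) with hδdef
  set r : ℕ → ℝ := fun N =>
    4 * (Λ * M.ρSNR) ^ 2 * (256 * M.powerBound ^ 2 * δ N + √(P N)) with hr
  have hPn : ∀ N, 0 ≤ P N := fun N => measureReal_nonneg
  have hδ0 : ∀ N, 0 < δ N := fun N => by positivity
  have hDle : ∀ N, D N ≤ r N * N := by
    intro N
    refine (hM.integral_norm_lmmse_sub_oracle_sq_le hΛ0 hΛ N (hkm N) (hkI N) (hδ0 N)).trans ?_
    have h1 : P N / δ N ≤ √(P N) := by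
      rw [div_le_iff₀ (hδ0 N)]
      calc P N = √(P N) * √(P N) := (Real.mul_self_sqrt (hPn N)).symm
        _ ≤ √(P N) * δ N := by
          gcongr
          exact le_add_of_nonneg_right (by positivity)
    calc _ ≤ 4 * (Λ * M.ρSNR) ^ 2 *
          (N * (256 * M.powerBound ^ 2 * δ N + √(P N))) := by gcongr
      _ = r N * N := by rw [hr]; ring
  have hr0 : Tendsto r atTop (𝓝 0) := by
    have h1 : Tendsto (fun N => √(P N)) atTop (𝓝 0) := by
      simpa [Function.comp_def] using (Real.continuous_sqrt.tendsto 0).comp hP0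
    have h2 : Tendsto δ atTop (𝓝 0) := by
      simpa [hδdef] using h1.add (tendsto_one_div_add_atTop_nhds_zero_nat (𝕜 := ℝ))
    simpa using ((h2.const_mul (256 * M.powerBound ^ 2)).add h1).const_mul (4 * (Λ * M.ρSNR) ^ 2)
  set c : ℝ := (4 * (1 + Λ * M.ρSNR))⁻¹ with hc
  have hc0 : 0 < c := by positivity
  have hlow : Tendsto (fun N => 1 - r N / c) atTop (𝓝 1) := by
    simpa using (hr0.div_const c).const_sub 1
  refine tendsto_of_tendsto_of_tendsto_of_le_of_le' hlow tendsto_const_nhds ?_ ?_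
  · filter_upwards [eventually_ge_atTop M.Ks, eventually_gt_atTop 0] with N hN hN0
    have hN0' : (0 : ℝ) < N := by exact_mod_cast hN0
    have heN : c * N ≤ e N := hM.le_oracle_error hΛ0 hΛ hN
    have hq0 : 0 < M.qlmmseError μ N (kMAP N) := by
      rw [hq]
      have := hD0 N
      have : 0 < c * N := by positivity
      linarith
    have hrn : 0 ≤ r N := by positivity
    rw [le_div_iff₀ hq0]
    have h1 : r N / c * (D N + e N) ≥ r N * N := by
      have : r N / c * (c * N) ≤ r N / c * (D N + e N) := by
        gcongr
        linarith [hD0 N]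
      calc r N * N = r N / c * (c * N) := by field_simp
        _ ≤ _ := this
    have := hmm N
    rw [hq, sub_mul, one_mul]
    linarith [hDle N]
  · refine .of_forall fun N => ?_
    refine div_le_one_of_le₀ (hmq N) ?_
    exact integral_nonneg fun ω => by positivity
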